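/- Let $\mathbf k$ be an algebraically closed field of characteristic $0$, let $U$ be an affine nonsingular surface over $\mathbf k$ with coordinates $x_1,x_2$ (functions for which $(x_1,x_2)\colon U\to\mathbb A^2$ is étale), and let $o\in U$ be a point with $x_1(o)=x_2(o)=0$. *Charts.* Let $U(k)$ be the $k$th space of the monster (Semple) tower over $U$ and $\pi_k\colon U(k)\to U(k-1)$ the projection; a point of $U(k)$ over $Q\in U(k-1)$ is a line in the fiber at $Q$ of the rank $2$ focal bundle. For each string $p_1\cdots p_k$ in the alphabet $\{1,2\}$ there is a chart $\mathcal C(p_1\cdots p_k)\cong U\times\mathbb A^k$ of $U(k)$ with two active coordinates $x_1(p_1\cdots p_k)$, $x_2(p_1\cdots p_k)$, where $\mathcal C(\varnothing)=U$ has active coordinates $x_1,x_2$. If $p_k=q$ and $\bar q$ is the other letter, then for $k\ge1$ put $$\mathbf r=x_q(p_1\cdots p_k)=x_q(p_1\cdots p_{k-1}),\qquad \mathbf d=x_{\bar q}(p_1\cdots p_{k-1}),\qquad \mathbf n=x_{\bar q}(p_1\cdots p_k)=\frac{d\mathbf d}{d\mathbf r},$$ where $\mathbf n$ is the new affine coordinate;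 thus the point with coordinate $\mathbf n$ represents the line of focal vectors on which $d\mathbf d=\mathbf n\,d\mathbf r$. Let $N(p_1\cdots p_k)$ be the point of this chart over $o$ at which the $k$ affine coordinates vanish. *Node binomials.* For $k\ge 1$ these are $B(p_1\cdots p_k)=\alpha\,\mathbf n\mathbf r+\beta\,\mathbf d$, where $(\alpha,\beta)$ is defined recursively: $(\alpha,\beta)=(1,1)$ for $k=1$; and if $(\alpha',\beta')$ belongs to $p_1\cdots p_{k-1}$ with $k\ge2$, then $(\alpha,\beta)=(\alpha',\alpha'+\beta')$ if $p_k=p_{k-1}$, and $(\alpha,\beta)=(\alpha'+\beta',\alpha')$ if $p_k\ne p_{k-1}$. *Prolongation of the nodal curve.* For $t\neq0$ let $X(k)_t\subset U(k)$ be the $k$th prolongation of the nonsingular curve $x_1x_2=t$, obtained by lifting $k$ times each point of the curve to the point representing the tangent line there. Let $\mathcal X(k)\subset U(k)\times\mathbb A^1$ be the flat family extending $\{X(k)_t\}_{t\ne0}$ over $t=0$, i.e. the closure of that family. Let $X(k)_0$ be its scheme-theoretic fiber over $t=0$ and $Z(k)_0$ the associated cycle, in which the multiplicity of an irreducible component is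 the length of the local ring of $X(k)_0$ at its generic point. The irreducible components of $X(k)_0$ are called twigs. **Theorem.** Let $k\ge1$ and write the node binomial as $B(p_1\cdots p_k)=\alpha\,\mathbf n\mathbf r+\beta\,\mathbf d$ with natural numbers $\alpha,\beta$. In the chart $\mathcal C(p_1\cdots p_k)$ there are exactly two twigs through $N(p_1\cdots p_k)$. Exactly one of them, the emergent twig, is collapsed by $\pi_k$ to the point $N(p_1\cdots p_{k-1})$; the other one, the retained twig, is mapped isomorphically by $\pi_k$ (within the charts) to a twig through $N(p_1\cdots p_{k-1})$ at level $k-1$. In $Z(k)_0$ the retained twig has multiplicity $\alpha$ and the emergent twig has multiplicity $\alpha+\beta$. -/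

import Mathlib

/-! Charts on the monster tower over a nonsingular surface, the prolonged family `x₁ x₂ = t`,
its flat limit at `t = 0`, and the twigs of that limit with their multiplicities.

Throughout, `R` is the coordinate ring of an affine surface `U` over a field `K`, `x 0` and `x 1`
in `R` are the coordinates `x₁` and `x₂`, and a string `p₁ ⋯ p_k` in the alphabet `{1, 2}` is a
function `p : Fin k → Fin 2`, the letters `1, 2` being written `0, 1`. The string
`p₁ ⋯ p_{k-1}` is then `Fin.init p` and the letter `p_k` is `p (Fin.last _)`. -/

namespace NodalProlongation

/-- The coordinate ring of a chart `C(p₁ ⋯ p_k) = U × 𝔸ᵏ` at level `k`. The `j`-th variable is the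
coordinate introduced in passing from level `j` to level `j + 1`. -/
abbrev ChartRing (R : Type*) [CommRing R] (k : ℕ) : Type _ := MvPolynomial (Fin k) R

/-- The `K`-points of a chart at level `k`. -/
abbrev ChartPoint (K R : Type*) [Field K] [CommRing R] [Algebra K R] (k : ℕ) : Type _ :=
  ChartRing R k →ₐ[K] K

/-- Pullback of functions under `π : C(p₁ ⋯ p_{k+1}) → C(p₁ ⋯ p_k)`, which forgets the last
coordinate. -/
noncomputable def pull (K R : Type*) [Field K] [CommRing R] [Algebra K R] (k : ℕ) :
    ChartRing R k →ₐ[K] ChartRing R (k + 1) :=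
  (MvPolynomial.rename (R := R) Fin.castSucc).restrictScalars K

/-- The map `π : C(p₁ ⋯ p_{k+1}) → C(p₁ ⋯ p_k)` on points. -/
noncomputable def proj {K R : Type*} [Field K] [CommRing R] [Algebra K R] {k : ℕ}
    (P : ChartPoint K R (k + 1)) : ChartPoint K R k :=
  P.comp (pull K R k)

/-- The active coordinates `x₁(p₁ ⋯ p_k)` and `x₂(p₁ ⋯ p_k)` (for `i = 0, 1`). If `p_{k+1} = q`,
then `x_q(p₁ ⋯ p_{k+1})` is the old `x_q(p₁ ⋯ p_k)`, and the opposite active coordinate is the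
newly introduced one. -/
noncomputable def active (K : Type*) {R : Type*} [Field K] [CommRing R] [Algebra K R]
    (x : Fin 2 → R) : (k : ℕ) → (Fin k → Fin 2) → Fin 2 → ChartRing R k
  | 0, _, i => MvPolynomial.C (x i)
  | k + 1, p, i =>
    if i = p (Fin.last k) then pull K R k (active K x k (Fin.init p) i)
    else MvPolynomial.X (Fin.last k)

/-- The new coordinate `n` in `C(p₁ ⋯ p_{k+1})`. -/
noncomputable def newCoord (R : Type*) [CommRing R] (k : ℕ) : ChartRing R (k + 1) :=
  MvPolynomial.X (Fin.last k)

/-- The coordinate on `C(p₁ ⋯ p_k)` that is retained in `C(p₁ ⋯ p_{k+1})`. -/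
noncomputable def retained (K : Type*) {R : Type*} [Field K] [CommRing R] [Algebra K R]
    (x : Fin 2 → R) {k : ℕ} (p : Fin (k + 1) → Fin 2) : ChartRing R k :=
  active K x k (Fin.init p) (p (Fin.last k))

/-- The coordinate on `C(p₁ ⋯ p_k)` that is deactivated in `C(p₁ ⋯ p_{k+1})`. -/
noncomputable def deactivated (K : Type*) {R : Type*} [Field K] [CommRing R] [Algebra K R]
    (x : Fin 2 → R) {k : ℕ} (p : Fin (k + 1) → Fin 2) : ChartRing R k :=
  active K x k (Fin.init p) (Fin.rev (p (Fin.last k)))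

/-- The tangent space of `Spec A` at a `K`-point `P`: the point derivations at `P`. The value
`δ f` is the value of the differential `df` on the tangent vector `δ`. -/
def tangentSpace {K A : Type*} [Field K] [CommRing A] [Algebra K A] (P : A →ₐ[K] K) :
    Submodule K (Module.Dual K A) where
  carrier := {δ | ∀ f g : A, δ (f * g) = P f * δ g + P g * δ f}
  add_mem' := by
    intro a b ha hb f g
    simp only [LinearMap.add_apply, ha f g, hb f g]
    ring
  zero_mem' := by
    intro f g
    simp
  smul_mem' := by
    intro c a ha f g
    simp only [LinearMap.smul_apply, ha f g, smul_eq_mul]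
    ring

/-- The tangent space at `P` of a (reduced) closed subset `C`, given by its `K`-points: the tangent
vectors of the ambient space that kill all functions vanishing on `C`. -/
def tangentSpaceOf {K A : Type*} [Field K] [CommRing A] [Algebra K A] (C : Set (A →ₐ[K] K))
    (P : A →ₐ[K] K) : Submodule K (Module.Dual K A) where
  carrier := {δ | δ ∈ tangentSpace P ∧ ∀ f : A, (∀ Q ∈ C, Q f = 0) → δ f = 0}
  add_mem' := by
    intro a b ha hb
    refine ⟨add_mem ha.1 hb.1, fun f hf => ?_⟩
    simp [ha.2 f hf, hb.2 f hf]
  zero_mem' := ⟨zero_mem _, fun f _ => by simp⟩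
  smul_mem' := by
    intro c a ha
    refine ⟨Submodule.smul_mem _ c ha.1, fun f hf => ?_⟩
    simp [ha.2 f hf]

/-- The vectors `δ` of `B` with `df(δ) = y · dg(δ)`, i.e. with slope `df/dg = y`. -/
def withSlope {K A : Type*} [Field K] [CommRing A] [Algebra K A]
    (B : Submodule K (Module.Dual K A)) (f g : A) (y : K) : Submodule K (Module.Dual K A) where
  carrier := {δ | δ ∈ B ∧ δ f = y * δ g}
  add_mem' := by
    intro a b ha hb
    refine ⟨add_mem ha.1 hb.1, ?_⟩
    simp only [LinearMap.add_apply, ha.2, hb.2]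
    ring
  zero_mem' := ⟨zero_mem _, by simp⟩
  smul_mem' := by
    intro c a ha
    refine ⟨Submodule.smul_mem _ c ha.1, ?_⟩
    simp only [LinearMap.smul_apply, ha.2, smul_eq_mul]
    ring

/-- The fiber at `P` of the focal bundle `𝓑(k)`. At level `0` it is the tangent space. A point `P`
of `C(p₁ ⋯ p_{k+1})` represents the line of those vectors in the focal bundle at `π(P)` on which
`d(deactivated)/d(retained)` is the last coordinate of `P`, and a tangent vector at `P` is focal
when `dπ` maps it into that line. -/
noncomputable def focal {K R : Type*} [Field K] [CommRing R] [Algebra K R] (x : Fin 2 → R) :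
    (k : ℕ) → (Fin k → Fin 2) → (P : ChartPoint K R k) →
      Submodule K (Module.Dual K (ChartRing R k))
  | 0, _, P => tangentSpace P
  | k + 1, p, P =>
    tangentSpace P ⊓
      (withSlope (focal x k (Fin.init p) (proj P)) (deactivated K x p) (retained K x p)
        (P (newCoord R k))).comap (pull K R k).toLinearMap.dualMap

/-- The tangent direction at `π(P)` represented by the point `P` of `C(p₁ ⋯ p_{k+1})`: a line in the
focal bundle at `π(P)`. -/
noncomputable def direction {K R : Type*} [Field K] [CommRing R] [Algebra K R] (x : Fin 2 → R)
    {k : ℕ} (p : Fin (k + 1) → Fin 2) (P : ChartPoint K R (k + 1)) :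
    Submodule K (Module.Dual K (ChartRing R k)) :=
  withSlope (focal x k (Fin.init p) (proj P)) (deactivated K x p) (retained K x p)
    (P (newCoord R k))

/-- The part in `C(p₁ ⋯ p_k)` of the `k`-th prolongation `X(k)_t` of the curve `x₁ x₂ = t`. A point
lies on the prolongation of a curve if it represents the tangent line of that curve. (For `t ≠ 0`
these curves are nonsingular, and no closure has to be taken.) -/
def prolongation {K R : Type*} [Field K] [CommRing R] [Algebra K R] (x : Fin 2 → R) (t : K) :
    (k : ℕ) → (Fin k → Fin 2) → Set (ChartPoint K R k)
  | 0, _ => {P | P (MvPolynomial.C (x 0)) * P (MvPolynomial.C (x 1)) = t}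
  | k + 1, p =>
    {P | proj P ∈ prolongation x t k (Fin.init p) ∧
      tangentSpaceOf (prolongation x t k (Fin.init p)) (proj P) = direction x p P}

/-- The ideal of the total space `𝓧(k)` in `C(p₁ ⋯ p_k) × 𝔸¹`, where the polynomial variable is `t`.
The flat family `𝓧(k)` is the closure of the family of the `X(k)_t` with `t ≠ 0`, so that its
ideal consists of all functions vanishing on that family. -/
noncomputable def familyIdeal (K : Type*) {R : Type*} [Field K] [CommRing R] [Algebra K R]
    (x : Fin 2 → R) (k : ℕ) (p : Fin k → Fin 2) : Ideal (Polynomial (ChartRing R k)) :=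
  ⨅ (t : K) (_ : t ≠ 0) (P : ChartPoint K R k) (_ : P ∈ prolongation x t k p),
    RingHom.ker (Polynomial.eval₂RingHom (P : ChartRing R k →+* K) t)

/-- The ideal in `C(p₁ ⋯ p_k)` of the central member `X(k)_0`, the scheme-theoretic fiber of `𝓧(k)`
over `t = 0`. -/
noncomputable def centralIdeal (K : Type*) {R : Type*} [Field K] [CommRing R] [Algebra K R]
    (x : Fin 2 → R) (k : ℕ) (p : Fin k → Fin 2) : Ideal (ChartRing R k) :=
  (familyIdeal K x k p).map (Polynomial.evalRingHom 0)

/-- The node `N(p₁ ⋯ p_k)`: the origin of the chart, lying over the point `o` of `U`. -/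
noncomputable def node {K R : Type*} [Field K] [CommRing R] [Algebra K R] (o : R →ₐ[K] K)
    (k : ℕ) : ChartPoint K R k :=
  o.comp ((MvPolynomial.aeval (fun _ : Fin k => (0 : R))).restrictScalars K)

/-- A twig through the node `N(p₁ ⋯ p_k)`: an irreducible component of `X(k)_0` containing the node,
given by its generic point. -/
def IsTwig {K R : Type*} [Field K] [CommRing R] [Algebra K R] (x : Fin 2 → R) (o : R →ₐ[K] K)
    (k : ℕ) (p : Fin k → Fin 2) (P : PrimeSpectrum (ChartRing R k)) : Prop :=
  P.asIdeal ∈ (centralIdeal K x k p).minimalPrimes ∧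
    P.asIdeal ≤ RingHom.ker (node o k : ChartRing R k →+* K)

/-- The image of a closed subvariety under `π` (its closure), given by the generic point. -/
noncomputable def imageTwig (K : Type*) {R : Type*} [Field K] [CommRing R] [Algebra K R] {k : ℕ}
    (P : PrimeSpectrum (ChartRing R (k + 1))) : PrimeSpectrum (ChartRing R k) :=
  PrimeSpectrum.comap (pull K R k : ChartRing R k →+* ChartRing R (k + 1)) P

/-- An emergent twig through `N(p₁ ⋯ p_{k+1})`: it is collapsed by `π` to the point
`N(p₁ ⋯ p_k)`. -/
def IsEmergent {K R : Type*} [Field K] [CommRing R] [Algebra K R] (x : Fin 2 → R)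
    (o : R →ₐ[K] K) {k : ℕ} (p : Fin (k + 1) → Fin 2)
    (P : PrimeSpectrum (ChartRing R (k + 1))) : Prop :=
  IsTwig x o (k + 1) p P ∧
    (imageTwig K P).asIdeal = RingHom.ker (node o k : ChartRing R k →+* K)

/-- A retained twig through `N(p₁ ⋯ p_{k+1})`: it is mapped isomorphically by `π` to a twig at the
preceding level. -/
def IsRetained {K R : Type*} [Field K] [CommRing R] [Algebra K R] (x : Fin 2 → R)
    (o : R →ₐ[K] K) {k : ℕ} (p : Fin (k + 1) → Fin 2)
    (P : PrimeSpectrum (ChartRing R (k + 1))) : Prop :=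
  IsTwig x o (k + 1) p P ∧ IsTwig x o k (Fin.init p) (imageTwig K P) ∧
    Function.Bijective (Ideal.quotientMap P.asIdeal
      (pull K R k : ChartRing R k →+* ChartRing R (k + 1))
      (le_refl (P.asIdeal.comap (pull K R k : ChartRing R k →+* ChartRing R (k + 1)))))

/-- The multiplicity of the component with generic point `P` in the cycle of the closed subscheme
with ideal `I`: the length of the local ring of the subscheme at `P`. -/
noncomputable def multiplicity {A : Type*} [CommRing A] (I : Ideal A) (P : PrimeSpectrum A) : ℕ∞ :=
  Module.length (Localization.AtPrime P.asIdeal)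
    (Localization.AtPrime P.asIdeal ⧸
      I.map (algebraMap A (Localization.AtPrime P.asIdeal)))

/-- The coefficients `(α, β)` of the node binomials, by recursion: `(1, 0)` for the empty string;
the regular choice (the only one at the first step, then `p_{k+1} = p_k`) sends `(α, β)` to
`(α, α + β)`, the critical choice (`p_{k+1} ≠ p_k`) sends `(α, β)` to `(α + β, α)`. -/
def nodeCoeffs : (k : ℕ) → (Fin k → Fin 2) → ℕ × ℕ
  | 0, _ => (1, 0)
  | 1, _ => (1, 1)
  | k + 2, p =>
    let c := nodeCoeffs (k + 1) (Fin.init p)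
    if p (Fin.last (k + 1)) = p (Fin.last k).castSucc then (c.1, c.1 + c.2)
    else (c.1 + c.2, c.1)

/-- The binomial `α n r + β d` in `C(p₁ ⋯ p_{k+1})`. -/
noncomputable def binomial (K : Type*) {R : Type*} [Field K] [CommRing R] [Algebra K R]
    (x : Fin 2 → R) {k : ℕ} (p : Fin (k + 1) → Fin 2) (α β : ℕ) : ChartRing R (k + 1) :=
  (α : ChartRing R (k + 1)) * newCoord R k * pull K R k (retained K x p) +
    (β : ChartRing R (k + 1)) * pull K R k (deactivated K x p)

/-- The node binomial `B(p₁ ⋯ p_{k+1})`. -/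
noncomputable def nodeBinomial (K : Type*) {R : Type*} [Field K] [CommRing R] [Algebra K R]
    (x : Fin 2 → R) {k : ℕ} (p : Fin (k + 1) → Fin 2) : ChartRing R (k + 1) :=
  binomial K x p (nodeCoeffs (k + 1) p).1 (nodeCoeffs (k + 1) p).2

end NodalProlongation

/-! Suppose that on the curves `x₁ x₂ = t` a monomial `r ^ b * d ^ a` in the active coordinates
equals a constant times `t`. Logarithmic differentiation gives `b dr / r + a dd / d = 0`, so the
lifted curve has `n = dd / dr = -(b / a) d / r`, that is, `a n r + b d = 0`. Substituting `d = -(a /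
b) n r` turns the monomial into a constant times `r ^ (a + b) * n ^ a`, and the argument repeats.
Starting from exponents `(1, 1)`, this recursion is the one for the node binomials, with `α = a` and
`β = b` (`nodeCoeffs_succ`, `param_binomial`, `exists_param_monomial`).

Near the node, the central member is thus the divisor of `r ^ (α + β) * n ^ α` on the closure of the
family. Where `r = 0`, also `d = 0`, which leaves the line over the previous node: the emergent
twig. Where `n = 0`, also `d = 0`, which gives a copy of the previous twig `d = 0`: the retained
twig. The multiplicities are the exponents.

Two points need care. First, the prolongation is defined by tangent spaces of point sets. It is
identified with the image of a map from `Spec L`, where `L = R[1 / (x₁ x₂)]` (`prolongation_eq`).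
The tangent lines come from the vector field `x₁ ∂₁ - x₂ ∂₂`, which preserves `x₁ x₂` and has the
active coordinates as eigenfunctions. Since `L` is reduced, the central ideal is then the kernel of
`param` plus `(x₁ x₂)` (`centralIdeal_eq`).

Second, no generators of that kernel are computed. Candidate prime ideals for the twigs are written
down by recursion (`twigIdeal`), and an induction up the tower (`TwigSystem.succ`) shows that they
contain the kernel and are generated, locally at the node, by the kernel and one active coordinate.
The main step is that every polynomial relation for `n` has all its coefficients in the ideal of the
node (`TwigSystem.coeff_mem_nodeIdeal`). `TwigSystem.isTwig_iff` and `TwigSystem.multiplicity_eq`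
then read off components and lengths. -/

namespace NodalProlongation

/-! ### Lengths, local generators, derivations and the Nullstellensatz -/

section CommutativeAlgebra

/-- If the maximal ideal of a local ring is generated by `u` modulo `I`, and `u ^ n` is the first
power of `u` in `I`, then the quotient by `I` has length `n`. -/
lemma length_quotient_eq_of_maximalIdeal_le {L : Type*} [CommRing L] [IsLocalRing L] (u : L)
    (hu : u ∈ IsLocalRing.maximalIdeal L) (n : ℕ) :
    ∀ I : Ideal L, IsLocalRing.maximalIdeal L ≤ I ⊔ Ideal.span {u} → u ^ n ∈ I →
      (∀ j < n, u ^ j ∉ I) → Module.length L (L ⧸ I) = n := by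
  induction n with
  | zero =>
    intro I _ h0 _
    rw [pow_zero, ← Ideal.eq_top_iff_one] at h0
    rw [Nat.cast_zero, Module.length_eq_zero_iff]
    exact Ideal.Quotient.subsingleton_iff.mpr h0
  | succ n ih =>
    intro I hI hn hj
    have hIm : I ≤ IsLocalRing.maximalIdeal L := by
      refine IsLocalRing.le_maximalIdeal fun h => hj 0 n.succ_pos ?_
      simp [h]
    -- The colon ideal `(I : u)`. Multiplication by `u` gives an exact sequence `0 → L/(I : u) → L/I
    -- → L/m → 0`, and `(I : u)` satisfies the hypotheses with exponent `n`.
    let J : Ideal L := Submodule.comap (LinearMap.mulLeft L u) I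
    have hmem : ∀ y, y ∈ J ↔ u * y ∈ I := fun y => Iff.rfl
    have hJ : Module.length L (L ⧸ J) = n := by
      refine ih J (hI.trans (sup_le_sup_right (fun y hy => I.mul_mem_left u hy) _)) ?_ ?_
      · rw [hmem, ← pow_succ']; exact hn
      · intro j hjn h
        rw [hmem, ← pow_succ'] at h
        exact hj (j + 1) (by omega) h
    let f : (L ⧸ J) →ₗ[L] (L ⧸ I) := Submodule.mapQ J I (LinearMap.mulLeft L u) le_rfl
    let g : (L ⧸ I) →ₗ[L] (L ⧸ IsLocalRing.maximalIdeal L) := Submodule.factor hIm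
    have hf : Function.Injective f := by
      rw [injective_iff_map_eq_zero]
      intro y
      obtain ⟨y, rfl⟩ := Submodule.Quotient.mk_surjective _ y
      intro h
      rw [Submodule.mapQ_apply, Submodule.Quotient.mk_eq_zero] at h
      rw [Submodule.Quotient.mk_eq_zero]
      exact h
    have hg : Function.Surjective g := Submodule.factor_surjective hIm
    have hfg : Function.Exact f g := by
      intro y
      obtain ⟨y, rfl⟩ := Submodule.Quotient.mk_surjective _ y
      have hgy : g (Submodule.Quotient.mk y) = Submodule.Quotient.mk y := rfl
      rw [hgy, Submodule.Quotient.mk_eq_zero]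
      constructor
      · intro hy
        obtain ⟨a, ha, b, hb, rfl⟩ := Submodule.mem_sup.mp (hI hy)
        obtain ⟨c, rfl⟩ := Ideal.mem_span_singleton'.mp hb
        refine ⟨Submodule.Quotient.mk c, ?_⟩
        rw [Submodule.mapQ_apply, Submodule.Quotient.eq, LinearMap.mulLeft_apply, mul_comm u c,
          sub_add_cancel_right]
        exact I.neg_mem ha
      · rintro ⟨z, hz⟩
        obtain ⟨z, rfl⟩ := Submodule.Quotient.mk_surjective _ z
        rw [Submodule.mapQ_apply, Submodule.Quotient.eq] at hz
        have h1 := hIm hz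
        have h2 : LinearMap.mulLeft L u z ∈ IsLocalRing.maximalIdeal L :=
          Ideal.mul_mem_right _ _ hu
        have h3 := Ideal.sub_mem _ h2 h1
        rwa [sub_sub_cancel] at h3
    have : IsSimpleModule L (L ⧸ IsLocalRing.maximalIdeal L) :=
      isSimpleModule_iff_isCoatom.mpr (IsLocalRing.maximalIdeal.isMaximal L).out
    rw [Module.length_eq_add_of_exact f g hf hg hfg, hJ, Module.length_eq_one]
    norm_cast

/-- A Noetherian local ring whose maximal ideal is generated by a nonzerodivisor is a domain. -/
lemma noZeroDivisors_of_maximalIdeal_eq_span {B : Type*} [CommRing B] [IsLocalRing B]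
    [IsNoetherianRing B] (v : B) (hm : IsLocalRing.maximalIdeal B = Ideal.span {v})
    (hv : ∀ b, v * b = 0 → b = 0) : NoZeroDivisors B := by
  have key : ∀ f : B, f ≠ 0 → ∃ n, ∃ a, IsUnit a ∧ f = a * v ^ n := by
    intro f hf
    -- By Krull's intersection theorem a nonzero element has finite order, hence is a unit times a
    -- power of `v`.
    have h : ∃ n, f ∉ IsLocalRing.maximalIdeal B ^ (n + 1) := by
      by_contra! h
      apply hf
      have := Ideal.iInf_pow_eq_bot_of_isLocalRing (IsLocalRing.maximalIdeal B)
        (Ideal.IsPrime.ne_top')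
      rw [← Ideal.mem_bot, ← this, Ideal.mem_iInf]
      rintro (_ | i)
      · simp
      · exact h i
    classical
    have h1 := Nat.find_spec h
    have h2 : f ∈ IsLocalRing.maximalIdeal B ^ (Nat.find h) := by
      rcases hn : Nat.find h with _ | n
      · simp
      · exact not_not.mp (Nat.find_min h (m := n) (by omega))
    generalize Nat.find h = n at h1 h2
    rw [hm, Ideal.span_singleton_pow] at h1 h2
    obtain ⟨a, ha⟩ := Ideal.mem_span_singleton'.mp h2
    refine ⟨_, a, ?_, ha.symm⟩
    by_contra hna
    have : a ∈ Ideal.span {v} := hm ▸ (IsLocalRing.mem_maximalIdeal a).mpr hna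
    obtain ⟨b, rfl⟩ := Ideal.mem_span_singleton'.mp this
    exact h1 (Ideal.mem_span_singleton'.mpr ⟨b, by rw [← ha]; ring⟩)
  have hpow : ∀ n b, v ^ n * b = 0 → b = 0 := by
    intro n
    induction n with
    | zero => simp
    | succ n ih => intro b h; exact hv _ (ih _ (by rw [← h]; ring))
  refine ⟨fun {f g} hfg => ?_⟩
  by_contra! h
  obtain ⟨n, a, ha, rfl⟩ := key f h.1
  obtain ⟨m, b, hb, rfl⟩ := key g h.2
  have : v ^ (n + m) * (a * b) = 0 := by rw [← hfg]; ring
  have h0 := hpow _ _ this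
  have := ha.mul hb
  rw [h0, isUnit_zero_iff] at this
  apply h.1
  rw [← one_mul (a * v ^ n), ← this, zero_mul]

/-- The ideal of the elements that lie in `I` locally at the prime `N`. -/
noncomputable def localClosure {A : Type*} [CommRing A] (I N : Ideal A) [N.IsPrime] : Ideal A :=
  (I.map (algebraMap A (Localization.AtPrime N))).comap (algebraMap A (Localization.AtPrime N))

lemma mem_localClosure {A : Type*} [CommRing A] {I N : Ideal A} [N.IsPrime] {f : A} :
    f ∈ localClosure I N ↔ ∃ s, s ∉ N ∧ s * f ∈ I := by
  rw [localClosure, Ideal.mem_comap, IsLocalization.algebraMap_mem_map_algebraMap_iff N.primeCompl]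
  rfl

lemma le_localClosure {A : Type*} [CommRing A] {I N : Ideal A} [N.IsPrime] :
    I ≤ localClosure I N := Ideal.le_comap_map

/-- If the maximal ideal `N` is locally generated by `a` and `b`, and `b` is a nonzerodivisor modulo
`a`, then the ideal of the elements locally divisible by `a` is prime. -/
lemma localClosure_isPrime {A : Type*} [CommRing A] [IsNoetherianRing A] (N : Ideal A) [N.IsPrime]
    (a b : A) (ha : a ∈ N) (hb : b ∈ N)
    (hN : ∀ f ∈ N, ∃ s, s ∉ N ∧ s * f ∈ Ideal.span {a, b})
    (hab : ∀ f, b * f ∈ Ideal.span {a} → f ∈ Ideal.span {a}) :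
    (localClosure (Ideal.span {a}) N).IsPrime := by
  let L := Localization.AtPrime N
  let I : Ideal L := (Ideal.span {a}).map (algebraMap A L)
  have hI : I ≤ IsLocalRing.maximalIdeal L := by
    rw [← Localization.AtPrime.map_eq_maximalIdeal]
    exact Ideal.map_mono ((Ideal.span_singleton_le_iff_mem _).mpr ha)
  have hItop : I ≠ ⊤ := fun h => IsLocalRing.maximalIdeal.isMaximal L |>.ne_top
    (top_le_iff.mp (h ▸ hI))
  have : Nontrivial (L ⧸ I) := Ideal.Quotient.nontrivial_iff.mpr hItop
  have : IsLocalRing (L ⧸ I) :=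
    IsLocalRing.of_surjective' (Ideal.Quotient.mk I) Ideal.Quotient.mk_surjective
  have : IsNoetherianRing L := IsLocalization.isNoetherianRing N.primeCompl L inferInstance
  have hmap : (IsLocalRing.maximalIdeal L).map (Ideal.Quotient.mk I) =
      IsLocalRing.maximalIdeal (L ⧸ I) :=
    IsLocalRing.eq_maximalIdeal
      (Ideal.IsMaximal.map_of_surjective_of_ker_le Ideal.Quotient.mk_surjective (by simpa using hI))
  have hnzd : NoZeroDivisors (L ⧸ I) := by
    refine noZeroDivisors_of_maximalIdeal_eq_span (Ideal.Quotient.mk I (algebraMap A L b)) ?_ ?_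
    · apply le_antisymm
      · rw [← hmap, ← Localization.AtPrime.map_eq_maximalIdeal, Ideal.map_map, Ideal.map_le_iff_le_comap]
        intro f hf
        obtain ⟨s, hs, hsf⟩ := hN f hf
        obtain ⟨c, d, hcd⟩ := Ideal.mem_span_pair.mp hsf
        have hu : IsUnit (algebraMap A L s) := IsLocalization.map_units L (⟨s, hs⟩ : N.primeCompl)
        have ha0 : Ideal.Quotient.mk I (algebraMap A L a) = 0 :=
          Ideal.Quotient.eq_zero_iff_mem.mpr
            (Ideal.mem_map_of_mem _ (Ideal.mem_span_singleton_self a))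
        have hu' := hu.map (Ideal.Quotient.mk I)
        rw [Ideal.mem_comap, RingHom.comp_apply, ← Ideal.unit_mul_mem_iff_mem _ hu',
          ← map_mul, ← map_mul, ← hcd, map_add, map_mul, map_mul, map_add, map_mul, map_mul, ha0,
          mul_zero, zero_add]
        exact Ideal.mul_mem_left _ _ (Ideal.mem_span_singleton_self _)
      · rw [Ideal.span_singleton_le_iff_mem, ← hmap]
        refine Ideal.mem_map_of_mem _ ?_
        rw [← Localization.AtPrime.map_eq_maximalIdeal]
        exact Ideal.mem_map_of_mem _ hb
    · intro y
      obtain ⟨y, rfl⟩ := Ideal.Quotient.mk_surjective y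
      obtain ⟨f, s, rfl⟩ := IsLocalization.exists_mk'_eq N.primeCompl y
      have hu : IsUnit (algebraMap A L s) := IsLocalization.map_units L s
      rw [← map_mul, Ideal.Quotient.eq_zero_iff_mem, Ideal.Quotient.eq_zero_iff_mem,
        ← Ideal.unit_mul_mem_iff_mem I hu, ← Ideal.unit_mul_mem_iff_mem I hu (x := IsLocalization.mk' L f s),
        mul_left_comm, IsLocalization.mk'_spec', ← map_mul]
      change b * f ∈ localClosure _ N → f ∈ localClosure _ N
      rw [mem_localClosure, mem_localClosure]
      rintro ⟨t, ht, h⟩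
      exact ⟨t, ht, hab _ (by rwa [mul_left_comm])⟩
  have : IsDomain (L ⧸ I) := NoZeroDivisors.to_isDomain _
  have hp : I.IsPrime := (Ideal.Quotient.isDomain_iff_prime I).mp this
  exact hp.comap _

/-- The radical of an ideal stable under a derivation of a `ℚ`-algebra is stable as well. -/
lemma derivation_mem_radical {A : Type*} [CommRing A] [Algebra ℚ A] {k : Type*} [CommRing k]
    [Algebra k A] (D : Derivation k A A) (I : Ideal A) (hD : ∀ f ∈ I, D f ∈ I) {f : A}
    (hf : f ∈ I.radical) : D f ∈ I.radical := by
  obtain ⟨m, hm⟩ := hf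
  -- Each differentiation trades one factor `f` for two factors `D f`: in `D f * D (f ^ (s + 1) * D
  -- f ^ (2 * i))` the term with `D (D f)` is a multiple of the element differentiated. The
  -- remaining factor `s + 1` is invertible over `ℚ`.
  have key : ∀ i s, i + s = m → f ^ s * D f ^ (2 * i) ∈ I := by
    intro i
    induction i with
    | zero => rintro s rfl; simpa using hm
    | succ i ih =>
      intro s hs
      have h := ih (s + 1) (by omega)
      have h1 := I.mul_mem_left (D f) (hD _ h)
      rw [Derivation.leibniz, Derivation.leibniz_pow, Derivation.leibniz_pow] at h1
      simp only [smul_eq_mul, nsmul_eq_mul, Nat.add_sub_cancel] at h1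
      have h2 : ((s + 1 : ℕ) : A) * (f ^ s * D f ^ (2 * (i + 1))) ∈ I := by
        rcases i with _ | i
        · simpa [pow_two, mul_comm, mul_left_comm, mul_assoc] using h1
        · have h3 := I.mul_mem_left (((2 * (i + 1) : ℕ) : A) * D (D f)) h
          have h4 := I.sub_mem h1 h3
          convert h4 using 1
          have : 2 * (i + 1) - 1 = 2 * i + 1 := by omega
          rw [this]
          ring
      have h5 := I.mul_mem_left (algebraMap ℚ A ((s + 1 : ℕ) : ℚ)⁻¹) h2
      rw [← mul_assoc, ← map_natCast (algebraMap ℚ A), ← map_mul, inv_mul_cancel₀, map_one,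
        one_mul] at h5
      · exact h5
      · positivity
  exact ⟨2 * m, by simpa using key m 0 (by omega)⟩

/-- In a finitely generated reduced algebra over an algebraically closed field, a function
vanishing at all points is zero. -/
lemma mem_radical_of_forall_point {K A : Type*} [Field K] [IsAlgClosed K] [CommRing A] [Algebra K A]
    [Algebra.FiniteType K A] (I : Ideal A) (f : A)
    (h : ∀ P : A →ₐ[K] K, (∀ g ∈ I, P g = 0) → P f = 0) : f ∈ I.radical := by
  have : IsJacobsonRing A := isJacobsonRing_of_finiteType (A := K)
  rw [Ideal.radical_eq_jacobson, Ideal.jacobson, Ideal.mem_sInf]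
  rintro M ⟨hIM, hM⟩
  let : Field (A ⧸ M) := Ideal.Quotient.field M
  have : Module.Finite K (A ⧸ M) := finite_of_finite_type_of_isJacobsonRing K (A ⧸ M)
  let e : K ≃ₐ[K] (A ⧸ M) := AlgEquiv.ofBijective (Algebra.ofId K (A ⧸ M))
    (IsAlgClosed.algebraMap_bijective_of_isIntegral)
  have h1 := h ((e.symm : (A ⧸ M) →ₐ[K] K).comp (Ideal.Quotient.mkₐ K M)) (fun g hg => by
    have : Ideal.Quotient.mk M g = 0 := Ideal.Quotient.eq_zero_iff_mem.mpr (hIM hg)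
    simp [this])
  have h2 : e.symm (Ideal.Quotient.mk M f) = 0 := h1
  rw [EmbeddingLike.map_eq_zero_iff] at h2
  exact Ideal.Quotient.eq_zero_iff_mem.mp h2

end CommutativeAlgebra

/-! ### Regular sequences under flat extension -/

section Flat

/-- A nonzerodivisor modulo `a` remains one under flat extension. -/
lemma mem_span_of_mul_mem_of_flat {S R : Type*} [CommRing S] [CommRing R] [Algebra S R]
    [Module.Flat S R] (a b : S) (h : ∀ c, a ∣ b * c → a ∣ c) {f : R}
    (hf : algebraMap S R b * f ∈ Ideal.span {algebraMap S R a}) :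
    f ∈ Ideal.span {algebraMap S R a} := by
  obtain ⟨g, hg⟩ := Ideal.mem_span_singleton'.mp hf
  -- By the equational criterion for flatness the relation `b f = a g` comes from relations `b c₀ =
  -- a c₁` in `S`. There `a` divides every `c₀`, and `f` is a combination of these.
  have hrel : ∑ l, (![b, -a] : Fin 2 → S) l • (![f, g] : Fin 2 → R) l = 0 := by
    simp only [Fin.sum_univ_two, Matrix.cons_val_zero, Matrix.cons_val_one, Algebra.smul_def,
      map_neg]
    linear_combination -hg
  obtain ⟨k, c, y, hcy, hc⟩ := Module.Flat.isTrivialRelation_of_sum_smul_eq_zero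
    (R := S) (M := R) (f := ![b, -a]) (x := ![f, g]) hrel
  have h0 := hcy 0
  simp only [Matrix.cons_val_zero] at h0
  rw [h0]
  refine Ideal.sum_mem _ fun l _ => ?_
  have h1 := hc l
  simp only [Fin.sum_univ_two, Matrix.cons_val_zero, Matrix.cons_val_one] at h1
  obtain ⟨d, hd⟩ := h (c 0 l) ⟨c 1 l, by linear_combination h1⟩
  rw [hd, Algebra.smul_def, map_mul, mul_assoc]
  exact Ideal.mul_mem_right _ _ (Ideal.mem_span_singleton_self _)

end Flat

/-! ### Consequences of étale coordinates on the surface -/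

section EtaleCoordinates

variable {K : Type*} [Field K] {R : Type*} [CommRing R] [Algebra K R] {x : Fin 2 → R}

/-- The coordinates `x 0` and `x 1` are étale. -/
abbrev EtaleCoordinates (x : Fin 2 → R) : Prop :=
  (MvPolynomial.aeval x : MvPolynomial (Fin 2) K →ₐ[K] R).toRingHom.Etale

lemma EtaleCoordinates.finiteType (hx : EtaleCoordinates (K := K) x) : Algebra.FiniteType K R := by
  let := (MvPolynomial.aeval x : MvPolynomial (Fin 2) K →ₐ[K] R).toRingHom.toAlgebra
  have : Algebra.Etale (MvPolynomial (Fin 2) K) R := hx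
  have : IsScalarTower K (MvPolynomial (Fin 2) K) R :=
    .of_algebraMap_eq' (AlgHom.comp_algebraMap (MvPolynomial.aeval x)).symm
  exact Algebra.FiniteType.trans (S := MvPolynomial (Fin 2) K) inferInstance inferInstance

/-- By flatness `R` embeds into its base change to the fraction field of the polynomial ring, and an
unramified algebra over a field is reduced. -/
lemma EtaleCoordinates.isReduced (hx : EtaleCoordinates (K := K) x) : IsReduced R := by
  let S := MvPolynomial (Fin 2) K
  let := (MvPolynomial.aeval x : MvPolynomial (Fin 2) K →ₐ[K] R).toRingHom.toAlgebra
  have : Algebra.Etale S R := hx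
  let F := FractionRing S
  have : IsReduced (TensorProduct S F R) := Algebra.FormallyUnramified.isReduced_of_field F _
  have hinj : Function.Injective (Algebra.TensorProduct.includeRight : R →ₐ[S] TensorProduct S F R) :=
    Algebra.TensorProduct.includeRight_injective (IsFractionRing.injective S F)
  exact isReduced_of_injective _ hinj

/-- Each of the coordinates is a nonzerodivisor modulo the other. -/
lemma EtaleCoordinates.mem_span_of_mul_mem (hx : EtaleCoordinates (K := K) x) {i j : Fin 2}
    (hij : i ≠ j) {f : R} (hf : x j * f ∈ Ideal.span {x i}) : f ∈ Ideal.span {x i} := by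
  let S := MvPolynomial (Fin 2) K
  let := (MvPolynomial.aeval x : MvPolynomial (Fin 2) K →ₐ[K] R).toRingHom.toAlgebra
  have : Algebra.Etale S R := hx
  have hX : ∀ i, algebraMap S R (MvPolynomial.X i) = x i := fun i => MvPolynomial.aeval_X x i
  rw [← hX i] at hf ⊢
  rw [← hX j] at hf
  refine mem_span_of_mul_mem_of_flat (S := S) _ _ (fun c hc => ?_) hf
  rw [MvPolynomial.X_dvd_mul_iff, MvPolynomial.X_dvd_X] at hc
  exact hc.resolve_left hij

lemma EtaleCoordinates.eq_zero_of_mul_eq_zero (hx : EtaleCoordinates (K := K) x) (i : Fin 2)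
    {f : R} (hf : x i * f = 0) : f = 0 := by
  let S := MvPolynomial (Fin 2) K
  let := (MvPolynomial.aeval x : MvPolynomial (Fin 2) K →ₐ[K] R).toRingHom.toAlgebra
  have : Algebra.Etale S R := hx
  have hX : ∀ i, algebraMap S R (MvPolynomial.X i) = x i := fun i => MvPolynomial.aeval_X x i
  rw [← hX i] at hf
  have h := mem_span_of_mul_mem_of_flat (S := S) 0 (MvPolynomial.X i) (f := f) (fun c hc => by
    have h0 : (MvPolynomial.X i : S) ≠ 0 := MvPolynomial.X_ne_zero i
    simpa [h0] using hc) (by rw [hf]; exact zero_mem _)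
  simpa using h

/-- The coordinates generate the maximal ideal of the point where they vanish, locally. -/
lemma EtaleCoordinates.exists_mul_mem_span_pair (hx : EtaleCoordinates (K := K) x) (o : R →ₐ[K] K)
    (ho : ∀ i, o (x i) = 0) {f : R} (hf : o f = 0) :
    ∃ s, o s ≠ 0 ∧ s * f ∈ Ideal.span {x 0, x 1} := by
  let S := MvPolynomial (Fin 2) K
  let := (MvPolynomial.aeval x : MvPolynomial (Fin 2) K →ₐ[K] R).toRingHom.toAlgebra
  have : Algebra.Etale S R := hx
  have hX : ∀ i, algebraMap S R (MvPolynomial.X i) = x i := fun i => MvPolynomial.aeval_X x i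
  let N : Ideal R := RingHom.ker (o : R →+* K)
  have hN : N.IsPrime := RingHom.ker_isPrime _
  let p : Ideal S := N.under S
  let _ : Algebra (Localization.AtPrime p) (Localization.AtPrime N) :=
    Localization.AtPrime.algebraOfLiesOver p N
  -- Unramifiedness: the maximal ideal of the local ring at `o` is generated by the functions of
  -- `x₁, x₂` that vanish at `o`, and these lie in `(x₁, x₂)`.
  have hmap := ((Algebra.isUnramifiedAt_iff_map_eq S p N).mp inferInstance).2
  have hp : p.map (algebraMap S R) ≤ Ideal.span {x 0, x 1} := by
    rw [Ideal.map_le_iff_le_comap]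
    intro s hs
    have h1 : ∀ s : S, algebraMap S R s - algebraMap K R (MvPolynomial.constantCoeff s) ∈
        Ideal.span {x 0, x 1} := by
      intro s
      induction s using MvPolynomial.induction_on with
      | C a =>
        have : algebraMap S R (MvPolynomial.C a) = algebraMap K R a :=
          (MvPolynomial.aeval x).commutes a
        simp [this]
      | add a b ha hb =>
        have := Ideal.add_mem _ ha hb
        rw [map_add, map_add, map_add]
        convert this using 1
        ring
      | mul_X a i _ =>
        rw [map_mul, map_mul, MvPolynomial.constantCoeff_X, mul_zero, map_zero, sub_zero, hX]
        refine Ideal.mul_mem_left _ _ (Ideal.subset_span ?_)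
        fin_cases i <;> simp
    have h2 : o (algebraMap S R s) = 0 := hs
    have h3 : Ideal.span {x 0, x 1} ≤ N := by
      rw [Ideal.span_le]
      rintro _ (rfl | rfl) <;> exact ho _
    have h4 : o (algebraMap S R s - algebraMap K R (MvPolynomial.constantCoeff s)) = 0 :=
      h3 (h1 s)
    rw [map_sub, h2, AlgHom.commutes, zero_sub, neg_eq_zero] at h4
    have h5 := h1 s
    rw [show MvPolynomial.constantCoeff s = 0 from h4, map_zero, sub_zero] at h5
    exact h5
  have hfm : algebraMap R (Localization.AtPrime N) f ∈ IsLocalRing.maximalIdeal _ := by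
    rw [← Localization.AtPrime.map_eq_maximalIdeal]
    exact Ideal.mem_map_of_mem _ hf
  rw [← hmap, IsScalarTower.algebraMap_eq S R (Localization.AtPrime N), ← Ideal.map_map] at hfm
  obtain ⟨s, hs, h⟩ := mem_localClosure.mp (Ideal.map_mono hp hfm)
  exact ⟨s, hs, h⟩

/-- A tangent vector is determined by the differentials of the coordinates. -/
lemma EtaleCoordinates.eq_zero_of_mem_tangentSpace (hx : EtaleCoordinates (K := K) x)
    {P : R →ₐ[K] K} {δ : Module.Dual K R} (hδ : δ ∈ tangentSpace P) (h : ∀ i, δ (x i) = 0) :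
    δ = 0 := by
  let S := MvPolynomial (Fin 2) K
  let := (MvPolynomial.aeval x : MvPolynomial (Fin 2) K →ₐ[K] R).toRingHom.toAlgebra
  have : Algebra.Etale S R := hx
  have hX : ∀ i, algebraMap S R (MvPolynomial.X i) = x i := fun i => MvPolynomial.aeval_X x i
  have hδ' : ∀ f g, δ (f * g) = P f * δ g + P g * δ f := hδ
  have hone : δ 1 = 0 := by
    have := hδ' 1 1
    simp only [mul_one, map_one, one_mul] at this
    linear_combination -this
  have hS : ∀ s : S, δ (algebraMap S R s) = 0 := by
    intro s
    induction s using MvPolynomial.induction_on with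
    | C a =>
      have : algebraMap S R (MvPolynomial.C a) = algebraMap K R a :=
        (MvPolynomial.aeval x).commutes a
      rw [this, Algebra.algebraMap_eq_smul_one, map_smul, hone, smul_zero]
    | add a b ha hb => rw [map_add, map_add, ha, hb, add_zero]
    | mul_X a i ha => rw [map_mul, hδ', ha, hX, h, mul_zero, mul_zero, add_zero]
  let _ : Algebra R K := (P : R →+* K).toAlgebra
  let _ : Algebra S K := ((algebraMap R K).comp (algebraMap S R)).toAlgebra
  have : IsScalarTower S R K := .of_algebraMap_eq' rfl
  -- As `δ` kills all polynomials in the coordinates, it is a derivation over `S`, and `Ω[R⁄S] = 0`.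
  let d : Derivation S R K :=
    { toFun := δ
      map_add' := map_add δ
      map_smul' := fun s f => by
        rw [Algebra.smul_def, hδ', hS, mul_zero, add_zero]
        rfl
      map_one_eq_zero' := hone
      leibniz' := fun f g => hδ' f g }
  ext f
  have h0 : d = 0 := by
    apply (Derivation.liftKaehlerDifferential_comp d).symm.trans
    rw [Subsingleton.elim d.liftKaehlerDifferential 0]
    ext; rfl
  exact congrArg (fun e : Derivation S R K => e f) h0

/-- The vector field `x₁ ∂₁ - x₂ ∂₂` on an étale extension. -/
lemma EtaleCoordinates.exists_derivation (hx : EtaleCoordinates (K := K) x) (L : Type*) [CommRing L]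
    [Algebra R L] [Algebra K L] [IsScalarTower K R L] [Algebra.FormallyEtale R L] :
    ∃ D : Derivation K L L, D (algebraMap R L (x 0)) = algebraMap R L (x 0) ∧
      D (algebraMap R L (x 1)) = -algebraMap R L (x 1) := by
  let S := MvPolynomial (Fin 2) K
  let _ := (MvPolynomial.aeval x : MvPolynomial (Fin 2) K →ₐ[K] R).toRingHom.toAlgebra
  have : Algebra.Etale S R := hx
  have : IsScalarTower K S R :=
    .of_algebraMap_eq' (AlgHom.comp_algebraMap (MvPolynomial.aeval x)).symm
  have hX : ∀ i, algebraMap S R (MvPolynomial.X i) = x i := fun i => MvPolynomial.aeval_X x i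
  let _ : Algebra S L := ((algebraMap R L).comp (algebraMap S R)).toAlgebra
  have : IsScalarTower S R L := .of_algebraMap_eq' rfl
  have : IsScalarTower K S L := .of_algebraMap_eq' (by
    rw [IsScalarTower.algebraMap_eq K R L, IsScalarTower.algebraMap_eq K S R,
      IsScalarTower.algebraMap_eq S R L, RingHom.comp_assoc])
  have : Algebra.FormallyEtale S L := .comp S R L
  have hXL : ∀ i, algebraMap S L (MvPolynomial.X i) = algebraMap R L (x i) := fun i => by
    rw [IsScalarTower.algebraMap_apply S R L, hX]
  let D₀ : Derivation K S L := MvPolynomial.mkDerivation K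
    ![algebraMap R L (x 0), -algebraMap R L (x 1)]
  -- Formal étaleness gives `Ω[L⁄K] = L ⊗ Ω[S⁄K]`, so derivations from the polynomial ring into `L`
  -- extend to `L`.
  let e := KaehlerDifferential.tensorKaehlerEquivOfFormallyEtale K S L
  let l : Ω[L⁄K] →ₗ[L] L := (LinearMap.liftBaseChange L D₀.liftKaehlerDifferential).comp
    e.symm.toLinearMap
  refine ⟨l.compDer (KaehlerDifferential.D K L), ?_, ?_⟩
  all_goals
    rw [← hXL]
    refine Eq.trans (b := l (KaehlerDifferential.D K L (algebraMap S L _))) rfl ?_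
    rw [LinearMap.comp_apply, LinearEquiv.coe_coe,
      KaehlerDifferential.tensorKaehlerEquivOfFormallyEtale_symm_D_algebraMap,
      LinearMap.liftBaseChange_tmul, one_smul, Derivation.liftKaehlerDifferential_comp_D,
      MvPolynomial.mkDerivation_X, hXL]
    rfl

end EtaleCoordinates

/-! ### The parametrization of the prolonged curves and the weights of the active coordinates -/

section Parametrization

lemma isUnit_natCast (K L : Type*) [Field K] [CharZero K] [CommRing L] [Algebra K L] {n : ℕ}
    (hn : 0 < n) : IsUnit (n : L) := by
  rw [← map_natCast (algebraMap K L)]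
  exact (IsUnit.mk0 (n : K) (by exact_mod_cast hn.ne')).map _

variable (K : Type*) {R : Type*} [Field K] [CommRing R] [Algebra K R] (x : Fin 2 → R)

/-- The exponents of the two active coordinates in the monomial that equals `x₁ x₂`, up to a
constant, on the prolonged curves. -/
def exponent : (k : ℕ) → (Fin k → Fin 2) → Fin 2 → ℕ
  | 0, _, _ => 1
  | k + 1, p, i =>
    if i = p (Fin.last k) then
      exponent k (Fin.init p) (p (Fin.last k)) + exponent k (Fin.init p) (p (Fin.last k)).rev
    else exponent k (Fin.init p) i

lemma exponent_pos : ∀ (k : ℕ) (p : Fin k → Fin 2) (i : Fin 2), 0 < exponent k p i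
  | 0, _, _ => Nat.one_pos
  | k + 1, p, i => by
    rw [exponent]
    split_ifs
    · exact Nat.add_pos_left (exponent_pos k _ _) _
    · exact exponent_pos k _ _

lemma eq_rev_of_ne {i q : Fin 2} (h : i ≠ q) : i = q.rev := by
  revert i q; decide

lemma rev_ne (q : Fin 2) : q.rev ≠ q := by
  revert q; decide

lemma exponent_last {k : ℕ} (p : Fin (k + 1) → Fin 2) :
    exponent (k + 1) p (p (Fin.last k)) =
      exponent k (Fin.init p) (p (Fin.last k)) + exponent k (Fin.init p) (p (Fin.last k)).rev := by
  rw [exponent, if_pos rfl]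

lemma exponent_rev_last {k : ℕ} (p : Fin (k + 1) → Fin 2) :
    exponent (k + 1) p (p (Fin.last k)).rev =
      exponent k (Fin.init p) (p (Fin.last k)).rev := by
  rw [exponent, if_neg (rev_ne _)]

/-- Links the two recursions: `α` is the exponent of the deactivated coordinate and `β` that of the
retained one, both at the preceding level. A regular choice retains the coordinate whose exponent
has just become a sum; a critical choice deactivates it. -/
lemma nodeCoeffs_succ : ∀ (k : ℕ) (p : Fin (k + 1) → Fin 2),
    nodeCoeffs (k + 1) p = (exponent k (Fin.init p) (p (Fin.last k)).rev,
      exponent k (Fin.init p) (p (Fin.last k)))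
  | 0, p => rfl
  | k + 1, p => by
    have hq : p (Fin.last k).castSucc = Fin.init p (Fin.last k) := rfl
    have h1 := exponent_last (Fin.init p)
    have h2 := exponent_rev_last (Fin.init p)
    rw [nodeCoeffs, nodeCoeffs_succ k (Fin.init p), hq]
    split_ifs with h
    · rw [h, h1, h2]
      exact Prod.ext rfl (Nat.add_comm _ _)
    · have h' := eq_rev_of_ne h
      rw [h', Fin.rev_rev, h1, h2, add_comm]

lemma active_last {k : ℕ} (p : Fin (k + 1) → Fin 2) :
    active K x (k + 1) p (p (Fin.last k)) = pull K R k (retained K x p) := by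
  rw [active, if_pos rfl, retained]

lemma active_rev_last {k : ℕ} (p : Fin (k + 1) → Fin 2) :
    active K x (k + 1) p (p (Fin.last k)).rev = newCoord R k := by
  rw [active, if_neg (rev_ne _), newCoord]

variable (R) in
@[simp] lemma pull_C (k : ℕ) (r : R) : pull K R k (MvPolynomial.C r) = MvPolynomial.C r :=
  MvPolynomial.rename_C _ _

variable (R) in
@[simp] lemma pull_X (k : ℕ) (j : Fin k) :
    pull K R k (MvPolynomial.X j) = MvPolynomial.X j.castSucc :=
  MvPolynomial.rename_X _ _

/-- Functions on a chart are generated by the functions on the preceding one and the new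
coordinate. -/
lemma chartRing_induction {k : ℕ} {motive : ChartRing R (k + 1) → Prop} (f : ChartRing R (k + 1))
    (h_pull : ∀ g, motive (pull K R k g)) (h_new : motive (newCoord R k))
    (h_add : ∀ f g, motive f → motive g → motive (f + g))
    (h_mul : ∀ f g, motive f → motive g → motive (f * g)) : motive f := by
  induction f using MvPolynomial.induction_on with
  | C a => rw [← pull_C K]; exact h_pull _
  | add f g hf hg => exact h_add f g hf hg
  | mul_X f j hf =>
    refine h_mul _ _ hf ?_
    refine Fin.lastCases h_new (fun j => ?_) j
    rw [← pull_X K]; exact h_pull _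

variable (L : Type*) [CommRing L] [Algebra R L] [Algebra K L] [IsScalarTower K R L]

/-- The parametrization of the prolonged curves by the points of `U` with `x₁ x₂ ≠ 0`: the new
coordinate is `- (β / α) (d / r)`. -/
noncomputable def param : (k : ℕ) → (Fin k → Fin 2) → ChartRing R k →ₐ[K] L
  | 0, _ => (MvPolynomial.aeval (R := R) (Fin.elim0 : Fin 0 → L)).restrictScalars K
  | k + 1, p => (MvPolynomial.aeval (R := R) (Fin.snoc (α := fun _ => L)
      (fun j => param k (Fin.init p) (MvPolynomial.X j))
      (-algebraMap K L (exponent k (Fin.init p) (p (Fin.last k)) /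
        exponent k (Fin.init p) (p (Fin.last k)).rev) *
        param k (Fin.init p) (deactivated K x p) *
        Ring.inverse (param k (Fin.init p) (retained K x p))))).restrictScalars K

lemma param_C : ∀ (k : ℕ) (p : Fin k → Fin 2) (r : R),
    param K x L k p (MvPolynomial.C r) = algebraMap R L r
  | 0, _, r => MvPolynomial.aeval_C _ r
  | _ + 1, _, r => MvPolynomial.aeval_C _ r

lemma param_pull {k : ℕ} (p : Fin (k + 1) → Fin 2) (f : ChartRing R k) :
    param K x L (k + 1) p (pull K R k f) = param K x L k (Fin.init p) f := by
  induction f using MvPolynomial.induction_on with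
  | C a => rw [pull_C, param_C, param_C]
  | add f g hf hg => rw [map_add, map_add, map_add, hf, hg]
  | mul_X f j hf =>
    rw [map_mul, map_mul, map_mul, hf, pull_X]
    congr 1
    exact (MvPolynomial.aeval_X _ _).trans (Fin.snoc_castSucc ..)

lemma param_newCoord {k : ℕ} (p : Fin (k + 1) → Fin 2) :
    param K x L (k + 1) p (newCoord R k) =
      -algebraMap K L (exponent k (Fin.init p) (p (Fin.last k)) /
        exponent k (Fin.init p) (p (Fin.last k)).rev) *
        param K x L k (Fin.init p) (deactivated K x p) *
        Ring.inverse (param K x L k (Fin.init p) (retained K x p)) :=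
  (MvPolynomial.aeval_X _ _).trans (Fin.snoc_last ..)

variable [CharZero K]

variable {L} (hL : ∀ i, IsUnit (algebraMap R L (x i)))

include hL

lemma isUnit_param_active : ∀ (k : ℕ) (p : Fin k → Fin 2) (i : Fin 2),
    IsUnit (param K x L k p (active K x k p i))
  | 0, _, i => by
    rw [active, param_C]; exact hL i
  | k + 1, p, i => by
    by_cases h : i = p (Fin.last k)
    · rw [h, active_last, param_pull]
      exact isUnit_param_active k _ _
    · rw [eq_rev_of_ne h, active_rev_last, param_newCoord]
      refine ((IsUnit.neg ?_).mul (isUnit_param_active k _ _)).mul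
        (isUnit_param_active k _ _).ringInverse
      refine (IsUnit.mk0 _ (div_ne_zero ?_ ?_)).map _
      all_goals exact_mod_cast (exponent_pos _ _ _).ne'

lemma isUnit_param_retained {k : ℕ} (p : Fin (k + 1) → Fin 2) :
    IsUnit (param K x L k (Fin.init p) (retained K x p)) :=
  isUnit_param_active K x hL k _ _

/-- The node binomial vanishes on the prolonged curves. -/
lemma param_binomial {k : ℕ} (p : Fin (k + 1) → Fin 2) :
    (exponent k (Fin.init p) (p (Fin.last k)).rev : L) * param K x L (k + 1) p (newCoord R k) *
        param K x L k (Fin.init p) (retained K x p) +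
      exponent k (Fin.init p) (p (Fin.last k)) * param K x L k (Fin.init p) (deactivated K x p)
      = 0 := by
  have hinv := Ring.inverse_mul_cancel _ (isUnit_param_retained K x hL p)
  have hd : algebraMap K L (exponent k (Fin.init p) (p (Fin.last k)).rev) *
      algebraMap K L (exponent k (Fin.init p) (p (Fin.last k)) /
        exponent k (Fin.init p) (p (Fin.last k)).rev) =
      algebraMap K L (exponent k (Fin.init p) (p (Fin.last k))) := by
    rw [← map_mul, mul_div_cancel₀]
    exact_mod_cast (exponent_pos _ _ _).ne'
  rw [map_natCast, map_natCast] at hd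
  rw [param_newCoord]
  linear_combination (-(exponent k (Fin.init p) (p (Fin.last k)).rev : L) * algebraMap K L
    (exponent k (Fin.init p) (p (Fin.last k)) / exponent k (Fin.init p) (p (Fin.last k)).rev) *
    param K x L k (Fin.init p) (deactivated K x p)) * hinv -
    param K x L k (Fin.init p) (deactivated K x p) * hd

/-- On the prolonged curves, `x₁ x₂` is a monomial in the active coordinates, up to a constant. -/
lemma exists_param_monomial : ∀ (k : ℕ) (p : Fin k → Fin 2), ∃ c : K, c ≠ 0 ∧
    algebraMap R L (x 0 * x 1) = algebraMap K L c *
      (param K x L k p (active K x k p 0) ^ exponent k p 0 *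
        param K x L k p (active K x k p 1) ^ exponent k p 1)
  | 0, p => by
    refine ⟨1, one_ne_zero, ?_⟩
    rw [map_one, one_mul, active, active, param_C, param_C, exponent, pow_one, exponent, pow_one,
      map_mul]
  | k + 1, p => by
    obtain ⟨c, hc, h⟩ := exists_param_monomial k (Fin.init p)
    have hsymm : ∀ (q : Fin 2) (k : ℕ) (p : Fin k → Fin 2),
        param K x L k p (active K x k p 0) ^ exponent k p 0 *
          param K x L k p (active K x k p 1) ^ exponent k p 1 =
        param K x L k p (active K x k p q) ^ exponent k p q *
          param K x L k p (active K x k p q.rev) ^ exponent k p q.rev := by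
      intro q k p
      fin_cases q
      · rfl
      · exact mul_comm _ _
    have hr : (exponent k (Fin.init p) (p (Fin.last k)) : K) ≠ 0 := by
      exact_mod_cast (exponent_pos _ _ _).ne'
    have hd : (exponent k (Fin.init p) (p (Fin.last k)).rev : K) ≠ 0 := by
      exact_mod_cast (exponent_pos _ _ _).ne'
    have hb := param_binomial K x hL p
    set a := exponent k (Fin.init p) (p (Fin.last k)).rev
    set b := exponent k (Fin.init p) (p (Fin.last k))
    -- Solving the binomial for `d`. Substitution in `r ^ b * d ^ a` yields a constant times `r ^ (a
    -- + b) * n ^ a`, which are the new exponents.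
    have hdd : param K x L k (Fin.init p) (deactivated K x p) = algebraMap K L (-(a / b)) *
        (param K x L k (Fin.init p) (retained K x p) *
          param K x L (k + 1) p (newCoord R k)) := by
      have hbb : algebraMap K L (b : K)⁻¹ * (b : L) = 1 := by
        rw [← map_natCast (algebraMap K L), ← map_mul, inv_mul_cancel₀ hr, map_one]
      rw [div_eq_mul_inv, map_neg, map_mul, map_natCast]
      linear_combination -(param K x L k (Fin.init p) (deactivated K x p)) * hbb +
        algebraMap K L (b : K)⁻¹ * hb
    refine ⟨c * (-(a / b)) ^ a, mul_ne_zero hc (pow_ne_zero _ (neg_ne_zero.mpr (div_ne_zero hd hr))),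
      ?_⟩
    rw [h, hsymm (p (Fin.last k)) k, hsymm (p (Fin.last k)) (k + 1), active_last, active_rev_last,
      param_pull, exponent_last, exponent_rev_last, map_mul, map_pow]
    change _ * (param K x L k (Fin.init p) (retained K x p) ^ b *
      param K x L k (Fin.init p) (deactivated K x p) ^ a) = _
    rw [hdd]
    ring

/-- The weights of the active coordinates under the vector field `x₁ ∂₁ - x₂ ∂₂`. -/
lemma derivation_param_active (D : Derivation K L L)
    (h0 : D (algebraMap R L (x 0)) = algebraMap R L (x 0))
    (h1 : D (algebraMap R L (x 1)) = -algebraMap R L (x 1)) :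
    ∀ (k : ℕ) (p : Fin k → Fin 2) (i : Fin 2),
      D (param K x L k p (active K x k p i)) =
        (if i = 0 then 1 else -1) * exponent k p i.rev * param K x L k p (active K x k p i)
  | 0, p, i => by
    rw [active, param_C, exponent]
    fin_cases i
    · simpa using h0
    · simpa using h1
  | k + 1, p, i => by
    by_cases h : i = p (Fin.last k)
    · rw [h, active_last, param_pull, exponent_rev_last]
      exact derivation_param_active D h0 h1 k _ _
    · have hr := derivation_param_active D h0 h1 k (Fin.init p) (p (Fin.last k))
      have hd := derivation_param_active D h0 h1 k (Fin.init p) (p (Fin.last k)).rev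
      rw [Fin.rev_rev] at hd
      rw [eq_rev_of_ne h, active_rev_last, Fin.rev_rev, exponent_last]
      have hb := param_binomial K x hL p
      have hu := isUnit_param_retained K x hL p
      have ha := isUnit_natCast K L (exponent_pos k (Fin.init p) (p (Fin.last k)).rev)
      rw [retained, deactivated] at hb
      rw [retained] at hu
      -- The weight of `n` comes from differentiating the binomial and cancelling the unit `a r`.
      have hDb := congrArg D hb
      simp only [map_add, Derivation.leibniz, Derivation.map_natCast, map_zero, smul_eq_mul, hr, hd,
        add_zero, mul_zero] at hDb
      refine (ha.mul hu).mul_left_cancel ?_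
      have hs : (if (p (Fin.last k)).rev = 0 then (1 : L) else -1) =
          -(if p (Fin.last k) = 0 then 1 else -1) := by
        generalize p (Fin.last k) = q
        fin_cases q <;> simp
      rw [hs] at hDb ⊢
      push_cast
      linear_combination hDb + (if p (Fin.last k) = 0 then 1 else -1) *
        (exponent k (Fin.init p) (p (Fin.last k)) : L) * hb

end Parametrization

/-! ### Tangent lines and focal directions along the prolonged curves -/

section Points

lemma map_one_of_mem_tangentSpace {K A : Type*} [Field K] [CommRing A] [Algebra K A]
    {P : A →ₐ[K] K} {δ : Module.Dual K A} (hδ : δ ∈ tangentSpace P) : δ 1 = 0 := by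
  have h : δ (1 * 1) = P 1 * δ 1 + P 1 * δ 1 := hδ 1 1
  simp only [mul_one, map_one, one_mul] at h
  linear_combination -h

lemma map_algebraMap_of_mem_tangentSpace {K A : Type*} [Field K] [CommRing A] [Algebra K A]
    {P : A →ₐ[K] K} {δ : Module.Dual K A} (hδ : δ ∈ tangentSpace P) (c : K) :
    δ (algebraMap K A c) = 0 := by
  rw [Algebra.algebraMap_eq_smul_one, map_smul, map_one_of_mem_tangentSpace hδ, smul_zero]

lemma comp_mem_tangentSpace {K A B : Type*} [Field K] [CommRing A] [Algebra K A] [CommRing B]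
    [Algebra K B] {P : B →ₐ[K] K} {δ : Module.Dual K B} (hδ : δ ∈ tangentSpace P)
    (φ : A →ₐ[K] B) : φ.toLinearMap.dualMap δ ∈ tangentSpace (P.comp φ) := by
  intro f g
  have h : δ (φ f * φ g) = P (φ f) * δ (φ g) + P (φ g) * δ (φ f) := hδ _ _
  change δ (φ (f * g)) = P (φ f) * δ (φ g) + P (φ g) * δ (φ f)
  rw [map_mul, h]

variable {K : Type*} {R : Type*} [Field K] [CommRing R] [Algebra K R] {x : Fin 2 → R}

/-- Used to climb the tower: two tangent vectors with the same image below need only be compared on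
the new coordinate. -/
lemma eq_zero_of_mem_tangentSpace_succ {k : ℕ} {P : ChartPoint K R (k + 1)}
    {δ : Module.Dual K (ChartRing R (k + 1))} (hδ : δ ∈ tangentSpace P)
    (hp : (pull K R k).toLinearMap.dualMap δ = 0) (hn : δ (newCoord R k) = 0) : δ = 0 := by
  refine LinearMap.ext fun f => ?_
  refine chartRing_induction K (motive := fun f => δ f = 0) f
    (fun g => congrArg (fun e : Module.Dual K (ChartRing R k) => e g) hp) hn ?_ ?_
  · intro f g hf hg
    rw [map_add, hf, hg, add_zero]
  · intro f g hf hg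
    have h : δ (f * g) = P f * δ g + P g * δ f := hδ f g
    rw [h, hf, hg]
    simp

lemma EtaleCoordinates.eq_zero_of_mem_tangentSpace_zero (hx : EtaleCoordinates (K := K) x)
    {P : ChartPoint K R 0} {δ : Module.Dual K (ChartRing R 0)} (hδ : δ ∈ tangentSpace P)
    (h : ∀ i, δ (MvPolynomial.C (x i)) = 0) : δ = 0 := by
  have h0 := hx.eq_zero_of_mem_tangentSpace
    (comp_mem_tangentSpace hδ (Algebra.ofId R (ChartRing R 0) |>.restrictScalars K)) h
  refine LinearMap.ext fun f => ?_
  obtain ⟨f, rfl⟩ := MvPolynomial.C_surjective (Fin 0) f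
  exact congrArg (fun e : Module.Dual K R => e f) h0

variable {L : Type*} [CommRing L] [Algebra R L] [Algebra K L] [IsScalarTower K R L]

/-- The tangent vector to the prolonged curve at a point of its parametrization, given by a vector
field on the parameter space. -/
noncomputable def velocity (x : Fin 2 → R) (D : Derivation K L L) (ρ : L →ₐ[K] K) (k : ℕ)
    (p : Fin k → Fin 2) : Module.Dual K (ChartRing R k) :=
  ρ.toLinearMap ∘ₗ (D : L →ₗ[K] L) ∘ₗ (param K x L k p).toLinearMap

lemma velocity_apply (D : Derivation K L L) (ρ : L →ₐ[K] K) (k : ℕ) (p : Fin k → Fin 2)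
    (f : ChartRing R k) : velocity x D ρ k p f = ρ (D (param K x L k p f)) := rfl

lemma velocity_mem_tangentSpace (D : Derivation K L L) (ρ : L →ₐ[K] K) (k : ℕ)
    (p : Fin k → Fin 2) : velocity x D ρ k p ∈ tangentSpace (ρ.comp (param K x L k p)) := by
  intro f g
  simp [velocity_apply]

lemma proj_comp_param (ρ : L →ₐ[K] K) {k : ℕ} (p : Fin (k + 1) → Fin 2) :
    proj (ρ.comp (param K x L (k + 1) p)) = ρ.comp (param K x L k (Fin.init p)) := by
  refine AlgHom.ext fun f => ?_
  exact congrArg ρ (param_pull K x L p f)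

lemma dualMap_velocity (D : Derivation K L L) (ρ : L →ₐ[K] K) {k : ℕ} (p : Fin (k + 1) → Fin 2) :
    (pull K R k).toLinearMap.dualMap (velocity x D ρ (k + 1) p) =
      velocity x D ρ k (Fin.init p) := by
  refine LinearMap.ext fun f => ?_
  exact congrArg (fun y => ρ (D y)) (param_pull K x L p f)

lemma eq_comp_param_iff (ρ : L →ₐ[K] K) {k : ℕ} (p : Fin (k + 1) → Fin 2)
    (P : ChartPoint K R (k + 1)) : P = ρ.comp (param K x L (k + 1) p) ↔
      proj P = ρ.comp (param K x L k (Fin.init p)) ∧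
        P (newCoord R k) = ρ (param K x L (k + 1) p (newCoord R k)) := by
  constructor
  · rintro rfl
    exact ⟨proj_comp_param ρ p, rfl⟩
  · rintro ⟨h1, h2⟩
    refine AlgHom.ext fun f => ?_
    refine chartRing_induction K
      (motive := fun f => P f = ρ (param K x L (k + 1) p f)) f (fun g => ?_) h2 ?_ ?_
    · refine Eq.trans ?_ (congrArg ρ (param_pull K x L p g)).symm
      exact congrArg (fun Q : ChartPoint K R k => Q g) h1
    · intro f g hf hg
      rw [map_add, map_add, map_add, hf, hg]
    · intro f g hf hg
      rw [map_mul, map_mul, map_mul, hf, hg]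

variable [CharZero K] (hL : ∀ i, IsUnit (algebraMap R L (x i)))
  (hx : EtaleCoordinates (K := K) x) {D : Derivation K L L}
  (h0 : D (algebraMap R L (x 0)) = algebraMap R L (x 0))
  (h1 : D (algebraMap R L (x 1)) = -algebraMap R L (x 1))

include hL

lemma active_apply_ne_zero (ρ : L →ₐ[K] K) (k : ℕ) (p : Fin k → Fin 2) (i : Fin 2) :
    ρ (param K x L k p (active K x k p i)) ≠ 0 :=
  ((isUnit_param_active K x hL k p i).map ρ).ne_zero

lemma binomial_apply (ρ : L →ₐ[K] K) {k : ℕ} (p : Fin (k + 1) → Fin 2) :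
    (exponent k (Fin.init p) (p (Fin.last k)).rev : K) *
        ρ (param K x L (k + 1) p (newCoord R k)) *
        ρ (param K x L k (Fin.init p) (retained K x p)) +
      exponent k (Fin.init p) (p (Fin.last k)) *
        ρ (param K x L k (Fin.init p) (deactivated K x p)) = 0 := by
  simpa using congrArg ρ (param_binomial K x hL p)

-- Étaleness reduces the claim to the values on `x₁` and `x₂`. As both are nonzero at the point, the
-- equation `d(x₁ x₂) = 0` leaves one degree of freedom, filled by the velocity.
omit [CharZero K] in
include hx in
lemma exists_eq_smul_velocity_zero
    (h0 : D (algebraMap R L (x 0)) = algebraMap R L (x 0))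
    (h1 : D (algebraMap R L (x 1)) = -algebraMap R L (x 1)) (ρ : L →ₐ[K] K) (p : Fin 0 → Fin 2)
    {δ : Module.Dual K (ChartRing R 0)} (hδ : δ ∈ tangentSpace (ρ.comp (param K x L 0 p)))
    (hxx : δ (MvPolynomial.C (x 0 * x 1)) = 0) : ∃ c : K, δ = c • velocity x D ρ 0 p := by
  have hu : ∀ i, ρ (algebraMap R L (x i)) ≠ 0 := fun i => ((hL i).map ρ).ne_zero
  refine ⟨δ (MvPolynomial.C (x 0)) / ρ (algebraMap R L (x 0)), ?_⟩
  rw [← sub_eq_zero]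
  refine hx.eq_zero_of_mem_tangentSpace_zero (Submodule.sub_mem _ hδ
    (Submodule.smul_mem _ _ (velocity_mem_tangentSpace D ρ 0 p))) ?_
  have hxx' : ρ (algebraMap R L (x 0)) * δ (MvPolynomial.C (x 1)) +
      ρ (algebraMap R L (x 1)) * δ (MvPolynomial.C (x 0)) = 0 := by
    have h : δ (MvPolynomial.C (x 0) * MvPolynomial.C (x 1)) = _ := hδ _ _
    rw [MvPolynomial.C_mul, h, AlgHom.comp_apply, AlgHom.comp_apply, param_C, param_C] at hxx
    exact hxx
  intro i
  rw [LinearMap.sub_apply, LinearMap.smul_apply, velocity_apply, param_C, smul_eq_mul]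
  have h00 := hu 0
  fin_cases i
  · simp only [Fin.zero_eta, h0]
    field_simp
    ring
  · simp only [Fin.mk_one, h1, map_neg]
    field_simp
    linear_combination hxx'

include hx in
/-- A tangent vector at a point of the prolonged curve that kills the equations of the curve is a
multiple of the velocity. -/
lemma exists_eq_smul_velocity_of_ker
    (h0 : D (algebraMap R L (x 0)) = algebraMap R L (x 0))
    (h1 : D (algebraMap R L (x 1)) = -algebraMap R L (x 1)) (ρ : L →ₐ[K] K) :
    ∀ (k : ℕ) (p : Fin k → Fin 2) (δ : Module.Dual K (ChartRing R k)),
      δ ∈ tangentSpace (ρ.comp (param K x L k p)) →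
      (∀ f, param K x L k p f = 0 → δ f = 0) → δ (MvPolynomial.C (x 0 * x 1)) = 0 →
      ∃ c : K, δ = c • velocity x D ρ k p
  | 0, p, δ, hδ, _, hxx => exists_eq_smul_velocity_zero hL hx h0 h1 ρ p hδ hxx
  | k + 1, p, δ, hδ, hker, hxx => by
    obtain ⟨c, hc⟩ := exists_eq_smul_velocity_of_ker h0 h1 ρ k (Fin.init p)
      ((pull K R k).toLinearMap.dualMap δ)
      (by
        have := comp_mem_tangentSpace hδ (pull K R k)
        rwa [← proj_comp_param ρ p])
      (fun f hf => hker _ ((param_pull K x L p f).trans hf))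
      (by
        change δ (pull K R k _) = 0
        rw [pull_C]; exact hxx)
    refine ⟨c, ?_⟩
    set ε := δ - c • velocity x D ρ (k + 1) p with hε
    have hεt : ε ∈ tangentSpace (ρ.comp (param K x L (k + 1) p)) := Submodule.sub_mem _ hδ
      (Submodule.smul_mem _ _ (velocity_mem_tangentSpace D ρ _ p))
    have hεp : (pull K R k).toLinearMap.dualMap ε = 0 := by
      rw [hε, map_sub, map_smul, dualMap_velocity, hc, sub_self]
    have hεker : ∀ f, param K x L (k + 1) p f = 0 → ε f = 0 := fun f hf => by
      rw [hε, LinearMap.sub_apply, LinearMap.smul_apply, velocity_apply, hf, hker f hf]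
      simp
    have hεpull : ∀ f, ε (pull K R k f) = 0 := fun f =>
      congrArg (fun e : Module.Dual K (ChartRing R k) => e f) hεp
    rw [← sub_eq_zero]
    refine eq_zero_of_mem_tangentSpace_succ hεt hεp ?_
    -- Since `ε` kills pullbacks, applying it to the binomial leaves only `a r ε(n) = 0`, with `a r`
    -- nonzero at the point.
    have hb := hεker ((exponent k (Fin.init p) (p (Fin.last k)).rev : K) •
        (newCoord R k * pull K R k (retained K x p)) +
      (exponent k (Fin.init p) (p (Fin.last k)) : K) • pull K R k (deactivated K x p)) (by
        rw [map_add, map_smul, map_smul, map_mul, param_pull, param_pull, Algebra.smul_def,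
          Algebra.smul_def, map_natCast, map_natCast, ← mul_assoc]
        exact param_binomial K x hL p)
    have hm : ε (newCoord R k * pull K R k (retained K x p)) = _ := hεt _ _
    rw [map_add, map_smul, map_smul, hεpull, smul_zero, add_zero, hm, hεpull, mul_zero, zero_add,
      AlgHom.comp_apply, param_pull, smul_eq_mul] at hb
    have hne := active_apply_ne_zero hL ρ k (Fin.init p) (p (Fin.last k))
    have ha : (exponent k (Fin.init p) (p (Fin.last k)).rev : K) ≠ 0 := by
      exact_mod_cast (exponent_pos _ _ _).ne'
    exact (mul_eq_zero.mp ((mul_eq_zero.mp hb).resolve_left ha)).resolve_left hne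

/-- The condition on a tangent vector that the logarithmic differential of the monomial which
describes `x₁ x₂` in terms of the active coordinates vanishes. -/
def IsLogTangent (x : Fin 2 → R) (ρ : L →ₐ[K] K) {k : ℕ} (p : Fin k → Fin 2)
    (δ : Module.Dual K (ChartRing R k)) (q : Fin 2) : Prop :=
  exponent k p q.rev * ρ (param K x L k p (active K x k p q)) * δ (active K x k p q.rev) +
    exponent k p q * ρ (param K x L k p (active K x k p q.rev)) * δ (active K x k p q) = 0

omit [CharZero K] hL in
lemma IsLogTangent.of_eq {ρ : L →ₐ[K] K} {k : ℕ} {p : Fin k → Fin 2}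
    {δ : Module.Dual K (ChartRing R k)} {q : Fin 2} (h : IsLogTangent x ρ p δ q) (q' : Fin 2) :
    IsLogTangent x ρ p δ q' := by
  by_cases hq : q' = q
  · rwa [hq]
  · rw [eq_rev_of_ne hq]
    unfold IsLogTangent at h ⊢
    rw [Fin.rev_rev]
    linear_combination h

omit [CharZero K] hL in
lemma IsLogTangent.sub_smul {ρ : L →ₐ[K] K} {k : ℕ} {p : Fin k → Fin 2}
    {δ δ' : Module.Dual K (ChartRing R k)} {q : Fin 2} (h : IsLogTangent x ρ p δ q)
    (h' : IsLogTangent x ρ p δ' q) (c : K) : IsLogTangent x ρ p (δ - c • δ') q := by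
  unfold IsLogTangent at h h' ⊢
  simp only [LinearMap.sub_apply, LinearMap.smul_apply, smul_eq_mul]
  linear_combination h - c * h'

lemma velocity_active (h0 : D (algebraMap R L (x 0)) = algebraMap R L (x 0))
    (h1 : D (algebraMap R L (x 1)) = -algebraMap R L (x 1)) (ρ : L →ₐ[K] K) (k : ℕ)
    (p : Fin k → Fin 2) (q : Fin 2) : velocity x D ρ k p (active K x k p q) =
      (if q = 0 then 1 else -1) * exponent k p q.rev * ρ (param K x L k p (active K x k p q)) := by
  rw [velocity_apply, derivation_param_active K x hL D h0 h1]
  split_ifs <;> simp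

lemma isLogTangent_velocity (h0 : D (algebraMap R L (x 0)) = algebraMap R L (x 0))
    (h1 : D (algebraMap R L (x 1)) = -algebraMap R L (x 1)) (ρ : L →ₐ[K] K) (k : ℕ)
    (p : Fin k → Fin 2) (q : Fin 2) : IsLogTangent x ρ p (velocity x D ρ k p) q := by
  refine IsLogTangent.of_eq (q := 0) ?_ q
  rw [IsLogTangent, velocity_active hL h0 h1, velocity_active hL h0 h1, Fin.rev_rev, if_pos rfl,
    if_neg (by decide)]
  ring

/-- The slope condition at the point of the prolonged curve. -/
lemma slope_iff_isLogTangent (ρ : L →ₐ[K] K) {k : ℕ} (p : Fin (k + 1) → Fin 2)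
    (δ : Module.Dual K (ChartRing R k)) :
    δ (deactivated K x p) = ρ (param K x L (k + 1) p (newCoord R k)) * δ (retained K x p) ↔
      IsLogTangent x ρ (Fin.init p) δ (p (Fin.last k)) := by
  have hb := binomial_apply hL ρ p
  have hne : ρ (param K x L k (Fin.init p) (retained K x p)) ≠ 0 :=
    active_apply_ne_zero hL ρ k (Fin.init p) (p (Fin.last k))
  have ha : (exponent k (Fin.init p) (p (Fin.last k)).rev : K) ≠ 0 := by
    exact_mod_cast (exponent_pos _ _ _).ne'
  change _ ↔ exponent k (Fin.init p) (p (Fin.last k)).rev *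
    ρ (param K x L k (Fin.init p) (retained K x p)) * δ (deactivated K x p) +
    exponent k (Fin.init p) (p (Fin.last k)) *
    ρ (param K x L k (Fin.init p) (deactivated K x p)) * δ (retained K x p) = 0
  constructor
  · intro h
    rw [h]
    linear_combination δ (retained K x p) * hb
  · intro h
    refine mul_left_cancel₀ (mul_ne_zero ha hne) ?_
    linear_combination h - δ (retained K x p) * hb

include hx in
/-- A focal vector at a point of the prolonged curve with the slope of the curve is a multiple of the
velocity. -/
lemma exists_eq_smul_velocity_of_focal
    (h0 : D (algebraMap R L (x 0)) = algebraMap R L (x 0))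
    (h1 : D (algebraMap R L (x 1)) = -algebraMap R L (x 1)) (ρ : L →ₐ[K] K) :
    ∀ (k : ℕ) (p : Fin k → Fin 2) (δ : Module.Dual K (ChartRing R k)),
      δ ∈ focal x k p (ρ.comp (param K x L k p)) → (∀ q, IsLogTangent x ρ p δ q) →
      ∃ c : K, δ = c • velocity x D ρ k p
  | 0, p, δ, hδ, hq => by
    refine exists_eq_smul_velocity_zero hL hx h0 h1 ρ p hδ ?_
    have h : δ (MvPolynomial.C (x 0) * MvPolynomial.C (x 1)) = _ := hδ _ _
    rw [MvPolynomial.C_mul, h]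
    simpa [IsLogTangent, exponent, active] using hq 0
  | k + 1, p, δ, hδ, hq => by
    obtain ⟨hδt, hδf, hδs⟩ := hδ
    rw [proj_comp_param] at hδf
    obtain ⟨c, hc⟩ := exists_eq_smul_velocity_of_focal h0 h1 ρ k (Fin.init p) _ hδf
      ((slope_iff_isLogTangent hL ρ p _).mp hδs).of_eq
    refine ⟨c, ?_⟩
    have hε := (hq (p (Fin.last k))).sub_smul (isLogTangent_velocity hL h0 h1 ρ (k + 1) p _) c
    have hεt : δ - c • velocity x D ρ (k + 1) p ∈ tangentSpace (ρ.comp (param K x L (k + 1) p)) :=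
      Submodule.sub_mem _ hδt (Submodule.smul_mem _ _ (velocity_mem_tangentSpace D ρ _ p))
    rw [← sub_eq_zero]
    generalize hεdef : δ - c • velocity x D ρ (k + 1) p = ε at *
    have hεp : (pull K R k).toLinearMap.dualMap ε = 0 := by
      rw [← hεdef, map_sub, map_smul, dualMap_velocity, hc, sub_self]
    have hεpull : ∀ f, ε (pull K R k f) = 0 := fun f =>
      congrArg (fun e : Module.Dual K (ChartRing R k) => e f) hεp
    refine eq_zero_of_mem_tangentSpace_succ hεt hεp ?_
    have hne := active_apply_ne_zero hL ρ (k + 1) p (p (Fin.last k))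
    have ha : (exponent (k + 1) p (p (Fin.last k)).rev : K) ≠ 0 := by
      exact_mod_cast (exponent_pos _ _ _).ne'
    -- Here no equation of the curve is available; the logarithmic condition at level `k + 1` takes
    -- its place. As `ε(r) = 0`, it reduces to a nonzero multiple of `ε(n)`.
    rw [IsLogTangent, active_rev_last, active_last, hεpull, mul_zero, add_zero] at hε
    rw [active_last] at hne
    exact (mul_eq_zero.mp hε).resolve_left (mul_ne_zero ha hne)

lemma velocity_mem_focal (h0 : D (algebraMap R L (x 0)) = algebraMap R L (x 0))
    (h1 : D (algebraMap R L (x 1)) = -algebraMap R L (x 1)) (ρ : L →ₐ[K] K) :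
    ∀ (k : ℕ) (p : Fin k → Fin 2),
      velocity x D ρ k p ∈ focal x k p (ρ.comp (param K x L k p))
  | 0, p => velocity_mem_tangentSpace D ρ 0 p
  | k + 1, p => by
    refine ⟨velocity_mem_tangentSpace D ρ _ p, ?_⟩
    rw [SetLike.mem_coe, Submodule.mem_comap, dualMap_velocity, proj_comp_param]
    exact ⟨velocity_mem_focal h0 h1 ρ k _,
      (slope_iff_isLogTangent hL ρ p _).mpr (isLogTangent_velocity hL h0 h1 ρ k _ _)⟩

-- A vector with `dr ≠ 0` has only one slope `dd/dr`. The velocity is such a vector, because `r` is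
-- nonzero at the point and has nonzero weight.
include hx in
lemma direction_eq_span (h0 : D (algebraMap R L (x 0)) = algebraMap R L (x 0))
    (h1 : D (algebraMap R L (x 1)) = -algebraMap R L (x 1)) (ρ : L →ₐ[K] K) {k : ℕ}
    (p : Fin (k + 1) → Fin 2) (P : ChartPoint K R (k + 1))
    (hP : proj P = ρ.comp (param K x L k (Fin.init p))) :
    direction x p P = Submodule.span K {velocity x D ρ k (Fin.init p)} ↔
      P (newCoord R k) = ρ (param K x L (k + 1) p (newCoord R k)) := by
  have hv := (slope_iff_isLogTangent hL ρ p _).mpr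
    (isLogTangent_velocity (D := D) hL h0 h1 ρ k (Fin.init p) (p (Fin.last k)))
  constructor
  · intro h
    have hmem : velocity x D ρ k (Fin.init p) ∈ direction x p P := by
      rw [h]; exact Submodule.mem_span_singleton_self _
    have hs : _ = P (newCoord R k) * _ := hmem.2
    rw [hv] at hs
    refine (mul_right_cancel₀ ?_ hs).symm
    rw [retained, velocity_active hL h0 h1]
    refine mul_ne_zero (mul_ne_zero ?_ ?_) (active_apply_ne_zero hL ρ _ _ _)
    · split_ifs <;> simp
    · exact_mod_cast (exponent_pos _ _ _).ne'
  · intro h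
    apply le_antisymm
    · rintro δ ⟨hδf, hδs⟩
      rw [hP] at hδf
      rw [h] at hδs
      obtain ⟨c, rfl⟩ := exists_eq_smul_velocity_of_focal hL hx h0 h1 ρ k _ δ hδf
        ((slope_iff_isLogTangent hL ρ p _).mp hδs).of_eq
      exact Submodule.smul_mem _ _ (Submodule.mem_span_singleton_self _)
    · rw [Submodule.span_singleton_le_iff_mem]
      refine ⟨?_, ?_⟩
      · rw [hP]; exact velocity_mem_focal hL h0 h1 ρ k _
      · rw [h]; exact hv

-- The equations from the kernel of `param` and `x₁ x₂ - t` already bound the tangent space by a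
-- line. Conversely, the vector field preserves the ideal `(x₁ x₂ - t)` of `L`, hence its radical,
-- so the velocity kills every function vanishing on the curve.
include hx in
lemma tangentSpaceOf_eq_span [IsAlgClosed K] [Algebra.FiniteType K L]
    (h0 : D (algebraMap R L (x 0)) = algebraMap R L (x 0))
    (h1 : D (algebraMap R L (x 1)) = -algebraMap R L (x 1)) (t : K) (ρ : L →ₐ[K] K)
    (hρ : ρ (algebraMap R L (x 0 * x 1)) = t) (k : ℕ) (p : Fin k → Fin 2)
    (C : Set (ChartPoint K R k))
    (hC : C = {P | ∃ ρ : L →ₐ[K] K, ρ (algebraMap R L (x 0 * x 1)) = t ∧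
      P = ρ.comp (param K x L k p)}) :
    tangentSpaceOf C (ρ.comp (param K x L k p)) = Submodule.span K {velocity x D ρ k p} := by
  apply le_antisymm
  · rintro δ ⟨hδt, hδ⟩
    have hker : ∀ f, param K x L k p f = 0 → δ f = 0 := by
      intro f hf
      refine hδ f ?_
      rw [hC]
      rintro _ ⟨ρ', -, rfl⟩
      rw [AlgHom.comp_apply, hf, map_zero]
    have hxx : δ (MvPolynomial.C (x 0 * x 1)) = 0 := by
      have h : δ (MvPolynomial.C (x 0 * x 1) - algebraMap K _ t) = 0 := by
        refine hδ _ ?_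
        rw [hC]
        rintro _ ⟨ρ', hρ', rfl⟩
        rw [map_sub, AlgHom.commutes, AlgHom.comp_apply, param_C, hρ']
        exact sub_self t
      rwa [map_sub, map_algebraMap_of_mem_tangentSpace hδt, sub_zero] at h
    obtain ⟨c, rfl⟩ := exists_eq_smul_velocity_of_ker hL hx h0 h1 ρ k p δ hδt hker hxx
    exact Submodule.smul_mem _ _ (Submodule.mem_span_singleton_self _)
  · rw [Submodule.span_singleton_le_iff_mem]
    refine ⟨velocity_mem_tangentSpace D ρ k p, fun f hf => ?_⟩
    let _ : Algebra ℚ L := ((algebraMap K L).comp (algebraMap ℚ K)).toAlgebra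
    let I : Ideal L := Ideal.span {algebraMap R L (x 0 * x 1) - algebraMap K L t}
    have hmem : param K x L k p f ∈ I.radical := by
      refine mem_radical_of_forall_point (K := K) I _ fun ρ' hρ' => ?_
      have h := hρ' _ (Ideal.mem_span_singleton_self _)
      rw [map_sub, AlgHom.commutes] at h
      refine hf (ρ'.comp (param K x L k p)) ?_
      rw [hC]
      exact ⟨ρ', sub_eq_zero.mp h, rfl⟩
    have hD : D (algebraMap R L (x 0 * x 1) - algebraMap K L t) = 0 := by
      rw [map_sub, Derivation.map_algebraMap, map_mul, Derivation.leibniz, h0, h1, smul_eq_mul,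
        smul_eq_mul]
      ring
    have hstab : ∀ g ∈ I, D g ∈ I := by
      intro g hg
      obtain ⟨g, rfl⟩ := Ideal.mem_span_singleton'.mp hg
      rw [Derivation.leibniz, hD, smul_zero, zero_add, smul_eq_mul]
      exact Ideal.mul_mem_right _ _ (Ideal.mem_span_singleton_self _)
    obtain ⟨m, hm⟩ := derivation_mem_radical D I hstab hmem
    obtain ⟨g, hg⟩ := Ideal.mem_span_singleton'.mp hm
    -- Evaluate at the point: `x₁ x₂ - t` vanishes there, so a power of the derivative of `f` along
    -- the velocity is zero.
    have h := congrArg ρ hg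
    rw [map_mul, map_sub, AlgHom.commutes, hρ, map_pow] at h
    rw [Algebra.algebraMap_self_apply, sub_self, mul_zero] at h
    exact eq_zero_of_pow_eq_zero h.symm

include hx in
/-- The prolonged curves over `t ≠ 0` are given by their parametrization. -/
lemma prolongation_eq [IsAlgClosed K] [Algebra.FiniteType K L] [IsLocalization.Away (x 0 * x 1) L]
    (h0 : D (algebraMap R L (x 0)) = algebraMap R L (x 0))
    (h1 : D (algebraMap R L (x 1)) = -algebraMap R L (x 1)) {t : K} (ht : t ≠ 0) :
    ∀ (k : ℕ) (p : Fin k → Fin 2), prolongation x t k p =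
      {P | ∃ ρ : L →ₐ[K] K, ρ (algebraMap R L (x 0 * x 1)) = t ∧ P = ρ.comp (param K x L k p)}
  | 0, p => by
    ext P
    constructor
    · intro hP
      have hP' : P (MvPolynomial.C (x 0 * x 1)) = t := by
        rw [MvPolynomial.C_mul, map_mul]; exact hP
      let P₀ : R →ₐ[K] K := P.comp ((Algebra.ofId R (ChartRing R 0)).restrictScalars K)
      -- As `t ≠ 0`, a point of the curve inverts `x₁ x₂` and therefore extends to a point of `L`.
      have hu : ∀ y : Submonoid.powers (x 0 * x 1), IsUnit (P₀ y) := by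
        rintro ⟨_, n, rfl⟩
        rw [map_pow]
        refine IsUnit.pow _ (IsUnit.mk0 _ ?_)
        exact (hP'.trans_ne ht)
      let ρ : L →ₐ[K] K := IsLocalization.liftAlgHom (M := Submonoid.powers (x 0 * x 1))
        (f := P₀) hu
      have hρ : ∀ r, ρ (algebraMap R L r) = P (MvPolynomial.C r) := fun r =>
        IsLocalization.lift_eq (M := Submonoid.powers (x 0 * x 1)) hu r
      refine ⟨ρ, (hρ _).trans hP', AlgHom.ext fun f => ?_⟩
      obtain ⟨f, rfl⟩ := MvPolynomial.C_surjective (Fin 0) f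
      rw [AlgHom.comp_apply, param_C, hρ]
    · rintro ⟨ρ, hρ, rfl⟩
      change ρ (param K x L 0 p _) * ρ (param K x L 0 p _) = t
      rw [param_C, param_C, ← map_mul, ← map_mul, hρ]
  | k + 1, p => by
    have ih := prolongation_eq h0 h1 ht k (Fin.init p)
    ext P
    constructor
    · rintro ⟨hP, hT⟩
      obtain ⟨ρ, hρ, hPρ⟩ := ih.subset hP
      rw [hPρ, tangentSpaceOf_eq_span hL hx h0 h1 t ρ hρ k _ _ ih] at hT
      exact ⟨ρ, hρ, (eq_comp_param_iff ρ p P).mpr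
        ⟨hPρ, (direction_eq_span hL hx h0 h1 ρ p P hPρ).mp hT.symm⟩⟩
    · rintro ⟨ρ, hρ, hP⟩
      obtain ⟨hPρ, hn⟩ := (eq_comp_param_iff ρ p P).mp hP
      refine ⟨ih.superset ⟨ρ, hρ, hPρ⟩, ?_⟩
      rw [hPρ, tangentSpaceOf_eq_span hL hx h0 h1 t ρ hρ k _ _ ih]
      exact ((direction_eq_span hL hx h0 h1 ρ p P hPρ).mpr hn).symm

end Points

/-! ### The flat limit as a quotient of the chart ring -/

section CentralMember

variable {K : Type*} {R : Type*} [Field K] [CommRing R] [Algebra K R] {x : Fin 2 → R}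
  {L : Type*} [CommRing L] [Algebra R L] [Algebra K L] [IsScalarTower K R L]
  [IsAlgClosed K] [CharZero K] [Algebra.FiniteType K L] [IsLocalization.Away (x 0 * x 1) L]
  [IsReduced L] (hL : ∀ i, IsUnit (algebraMap R L (x i)))
  (hx : EtaleCoordinates (K := K) x) {D : Derivation K L L}
  (h0 : D (algebraMap R L (x 0)) = algebraMap R L (x 0))
  (h1 : D (algebraMap R L (x 1)) = -algebraMap R L (x 1))

include hL hx h0 h1

/-- The points of the family are the points of `Spec L`, with `t` the value of `x₁ x₂`; a function
vanishing at all of them is zero because `L` is reduced of finite type. -/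
lemma mem_familyIdeal_iff (k : ℕ) (p : Fin k → Fin 2) (F : Polynomial (ChartRing R k)) :
    F ∈ familyIdeal K x k p ↔
      F.eval₂ (param K x L k p : ChartRing R k →+* L) (algebraMap R L (x 0 * x 1)) = 0 := by
  have hev : ∀ ρ : L →ₐ[K] K, F.eval₂ (ρ.comp (param K x L k p) : ChartRing R k →+* K)
      (ρ (algebraMap R L (x 0 * x 1))) =
      ρ (F.eval₂ (param K x L k p : ChartRing R k →+* L) (algebraMap R L (x 0 * x 1))) := fun ρ =>
    (Polynomial.hom_eval₂ F _ (ρ : L →+* K) _).symm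
  simp only [familyIdeal, Ideal.mem_iInf, RingHom.mem_ker, Polynomial.coe_eval₂RingHom]
  constructor
  · intro h
    have hrad := mem_radical_of_forall_point (K := K) (⊥ : Ideal L)
      (F.eval₂ (param K x L k p : ChartRing R k →+* L) (algebraMap R L (x 0 * x 1)))
      (fun ρ _ => by
        have hne : ρ (algebraMap R L (x 0 * x 1)) ≠ 0 := by
          rw [map_mul]
          exact (((hL 0).mul (hL 1)).map ρ).ne_zero
        rw [← hev]
        refine h _ hne _ ?_
        rw [prolongation_eq hL hx h0 h1 hne]
        exact ⟨ρ, rfl, rfl⟩)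
    obtain ⟨n, hn⟩ := hrad
    exact eq_zero_of_pow_eq_zero hn
  · intro h t ht P hP
    rw [prolongation_eq (L := L) hL hx h0 h1 ht] at hP
    obtain ⟨ρ, rfl, rfl⟩ := hP
    rw [hev, h, map_zero]

/-- The central member is cut out by `x₁ x₂ = 0` on the closure of the prolonged curves. -/
lemma centralIdeal_eq (k : ℕ) (p : Fin k → Fin 2) :
    centralIdeal K x k p = RingHom.ker (param K x L k p : ChartRing R k →+* L) ⊔
      Ideal.span {MvPolynomial.C (x 0 * x 1)} := by
  have hmem := mem_familyIdeal_iff (L := L) hL hx h0 h1 k p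
  apply le_antisymm
  · rw [centralIdeal, Ideal.map_le_iff_le_comap]
    intro F hF
    rw [hmem, ← Polynomial.divX_mul_X_add F, Polynomial.eval₂_add, Polynomial.eval₂_mul,
      Polynomial.eval₂_X, Polynomial.eval₂_C] at hF
    rw [Ideal.mem_comap, Polynomial.coe_evalRingHom, ← Polynomial.coeff_zero_eq_eval_zero]
    -- Substituting `x₁ x₂` for `t`. For `F = F₀ + t G` in the family ideal, this makes `F₀ + g x₁
    -- x₂` lie in the kernel of `param`.
    have key : ∀ G : Polynomial (ChartRing R k), ∃ g : ChartRing R k, param K x L k p g =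
        G.eval₂ (param K x L k p : ChartRing R k →+* L) (algebraMap R L (x 0 * x 1)) := by
      intro G
      refine ⟨G.eval (MvPolynomial.C (x 0 * x 1)), ?_⟩
      rw [← param_C K x L k p (x 0 * x 1)]
      exact (Polynomial.eval₂_at_apply (param K x L k p : ChartRing R k →+* L) _).symm
    obtain ⟨g, hg⟩ := key F.divX
    rw [← add_sub_cancel_right (F.coeff 0) (g * MvPolynomial.C (x 0 * x 1))]
    refine Ideal.sub_mem _ (Ideal.mem_sup_left ?_) (Ideal.mem_sup_right
      (Ideal.mul_mem_left _ _ (Ideal.mem_span_singleton_self _)))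
    rw [RingHom.mem_ker, AlgHom.coe_toRingHom, map_add, map_mul, param_C, hg, add_comm]
    exact hF
  · refine sup_le ?_ ?_
    · intro f hf
      have : Polynomial.C f ∈ familyIdeal K x k p := by
        rw [hmem, Polynomial.eval₂_C]; exact hf
      have h := Ideal.mem_map_of_mem (Polynomial.evalRingHom 0) this
      rwa [Polynomial.coe_evalRingHom, Polynomial.eval_C] at h
    · rw [Ideal.span_singleton_le_iff_mem]
      have : Polynomial.C (MvPolynomial.C (x 0 * x 1)) - Polynomial.X ∈ familyIdeal K x k p := by
        rw [hmem, Polynomial.eval₂_sub, Polynomial.eval₂_C, Polynomial.eval₂_X,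
          AlgHom.coe_toRingHom, param_C, sub_self]
      have h := Ideal.mem_map_of_mem (Polynomial.evalRingHom 0) this
      rwa [Polynomial.coe_evalRingHom, Polynomial.eval_sub, Polynomial.eval_C, Polynomial.eval_X,
        sub_zero] at h

end CentralMember

/-! ### Candidate twig ideals and the base of the induction -/

section Twigs

variable {K : Type*} {R : Type*} [Field K] [CommRing R] [Algebra K R]

/-- Functions on a chart as polynomials in the new coordinate. -/
noncomputable def chartEquiv (R : Type*) [CommRing R] (k : ℕ) :
    ChartRing R (k + 1) ≃ₐ[R] Polynomial (ChartRing R k) :=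
  (MvPolynomial.renameEquiv R finSuccEquivLast).trans (MvPolynomial.optionEquivLeft R (Fin k))

variable (K) in
lemma chartEquiv_pull {k : ℕ} (f : ChartRing R k) :
    chartEquiv R k (pull K R k f) = Polynomial.C f := by
  induction f using MvPolynomial.induction_on with
  | C a => simp [chartEquiv]
  | add f g hf hg => rw [map_add, map_add, map_add, hf, hg]
  | mul_X f j hf =>
    rw [map_mul, map_mul, map_mul, hf, pull_X]
    simp [chartEquiv]

lemma chartEquiv_newCoord (k : ℕ) : chartEquiv R k (newCoord R k) = Polynomial.X := by
  simp [chartEquiv, newCoord]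

variable (K) in
lemma chartEquiv_symm_C {k : ℕ} (f : ChartRing R k) :
    (chartEquiv R k).symm (Polynomial.C f) = pull K R k f := by
  rw [AlgEquiv.symm_apply_eq, chartEquiv_pull]

lemma chartEquiv_symm_X (k : ℕ) : (chartEquiv R k).symm Polynomial.X = newCoord R k := by
  rw [AlgEquiv.symm_apply_eq, chartEquiv_newCoord]

variable (K) in
lemma exists_eq_pull_add (k : ℕ) (f : ChartRing R (k + 1)) :
    ∃ g, f = pull K R k ((chartEquiv R k f).eval 0) + newCoord R k * g := by
  refine ⟨(chartEquiv R k).symm (chartEquiv R k f).divX, ?_⟩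
  apply (chartEquiv R k).injective
  rw [map_add, map_mul, chartEquiv_pull, chartEquiv_newCoord, AlgEquiv.apply_symm_apply,
    ← Polynomial.coeff_zero_eq_eval_zero]
  linear_combination -Polynomial.divX_mul_X_add (chartEquiv R k f)

lemma node_C (o : R →ₐ[K] K) (k : ℕ) (r : R) : node o k (MvPolynomial.C r) = o r :=
  congrArg o (MvPolynomial.aeval_C _ r)

lemma node_X (o : R →ₐ[K] K) (k : ℕ) (j : Fin k) : node o k (MvPolynomial.X j) = 0 :=
  (congrArg o (MvPolynomial.aeval_X _ _)).trans (map_zero o)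

lemma node_pull (o : R →ₐ[K] K) {k : ℕ} (f : ChartRing R k) :
    node o (k + 1) (pull K R k f) = node o k f := by
  induction f using MvPolynomial.induction_on with
  | C a => rw [pull_C, node_C, node_C]
  | add f g hf hg => rw [map_add, map_add, map_add, hf, hg]
  | mul_X f j hf =>
    rw [map_mul, map_mul, map_mul, hf, pull_X]
    rw [node_X, node_X]

lemma node_newCoord (o : R →ₐ[K] K) (k : ℕ) : node o (k + 1) (newCoord R k) = 0 :=
  node_X o _ _

/-- The maximal ideal of the node. -/
noncomputable abbrev nodeIdeal (o : R →ₐ[K] K) (k : ℕ) : Ideal (ChartRing R k) :=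
  RingHom.ker (node o k : ChartRing R k →+* K)

instance (o : R →ₐ[K] K) (k : ℕ) : (nodeIdeal o k).IsPrime := RingHom.ker_isPrime _

lemma eval_node_chartEquiv (o : R →ₐ[K] K) (k : ℕ) (f : ChartRing R (k + 1)) :
    node o k ((chartEquiv R k f).eval 0) = node o (k + 1) f := by
  obtain ⟨g, hg⟩ := exists_eq_pull_add K k f
  conv_rhs => rw [hg]
  rw [map_add, map_mul, node_newCoord, zero_mul, add_zero, node_pull]

/-- The ideals of the two twigs through the node: for each of the two active coordinates, the
component of the central member on which it vanishes. -/
noncomputable def twigIdeal (x : Fin 2 → R) (o : R →ₐ[K] K) :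
    (k : ℕ) → (Fin k → Fin 2) → Fin 2 → Ideal (ChartRing R k)
  | 0, _, i => localClosure (Ideal.span {MvPolynomial.C (x i)}) (nodeIdeal o 0)
  | k + 1, p, i =>
    -- For `r = 0` the twig is the whole line over the node. For the new coordinate it is the
    -- section `n = 0` over the old twig on which the deactivated coordinate, of the same index,
    -- vanishes.
    if i = p (Fin.last k) then
      RingHom.ker ((Polynomial.mapRingHom (node o k : ChartRing R k →+* K)).comp
        (chartEquiv R k : ChartRing R (k + 1) →+* Polynomial (ChartRing R k)))
    else (twigIdeal x o k (Fin.init p) i).comap ((Polynomial.evalRingHom 0).comp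
      (chartEquiv R k : ChartRing R (k + 1) →+* Polynomial (ChartRing R k)))

lemma mem_twigIdeal_last {x : Fin 2 → R} {o : R →ₐ[K] K} {k : ℕ} {p : Fin (k + 1) → Fin 2}
    {f : ChartRing R (k + 1)} : f ∈ twigIdeal x o (k + 1) p (p (Fin.last k)) ↔
      ∀ j, (chartEquiv R k f).coeff j ∈ nodeIdeal o k := by
  rw [twigIdeal, if_pos rfl, RingHom.mem_ker, RingHom.comp_apply, Polynomial.ext_iff]
  simp [Polynomial.coeff_map]

lemma mem_twigIdeal_rev_last {x : Fin 2 → R} {o : R →ₐ[K] K} {k : ℕ} {p : Fin (k + 1) → Fin 2}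
    {f : ChartRing R (k + 1)} : f ∈ twigIdeal x o (k + 1) p (p (Fin.last k)).rev ↔
      (chartEquiv R k f).eval 0 ∈ twigIdeal x o k (Fin.init p) (p (Fin.last k)).rev := by
  rw [twigIdeal, if_neg (rev_ne _)]
  rfl

lemma pull_mem_localClosure {o : R →ₐ[K] K} {k : ℕ} {f : ChartRing R k} {I : Ideal (ChartRing R k)}
    {J : Ideal (ChartRing R (k + 1))} (hIJ : ∀ g ∈ I, pull K R k g ∈ J)
    (hf : f ∈ localClosure I (nodeIdeal o k)) :
    pull K R k f ∈ localClosure J (nodeIdeal o (k + 1)) := by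
  obtain ⟨s, hs, h⟩ := mem_localClosure.mp hf
  refine mem_localClosure.mpr ⟨pull K R k s, fun h' => hs ?_, ?_⟩
  · exact (node_pull o s).symm.trans h'
  · rw [← map_mul]; exact hIJ _ h

/-- The properties of the twigs through the node that are carried along the tower. -/
structure TwigSystem (x : Fin 2 → R) (o : R →ₐ[K] K) (L : Type*) [CommRing L] [Algebra R L]
    [Algebra K L] [IsScalarTower K R L] (k : ℕ) (p : Fin k → Fin 2) : Prop where
  isPrime : ∀ i, (twigIdeal x o k p i).IsPrime
  le_nodeIdeal : ∀ i, twigIdeal x o k p i ≤ nodeIdeal o k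
  ker_le : ∀ i, RingHom.ker (param K x L k p : ChartRing R k →+* L) ≤ twigIdeal x o k p i
  active_mem : ∀ i, active K x k p i ∈ twigIdeal x o k p i
  active_rev_notMem : ∀ i, active K x k p i.rev ∉ twigIdeal x o k p i
  le_localClosure : ∀ i, twigIdeal x o k p i ≤ localClosure
    (RingHom.ker (param K x L k p : ChartRing R k →+* L) ⊔ Ideal.span {active K x k p i})
    (nodeIdeal o k)
  nodeIdeal_le_localClosure : nodeIdeal o k ≤ localClosure
    (RingHom.ker (param K x L k p : ChartRing R k →+* L) ⊔
      Ideal.span (Set.range (active K x k p))) (nodeIdeal o k)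

variable {x : Fin 2 → R} {o : R →ₐ[K] K} {L : Type*} [CommRing L] [Algebra R L] [Algebra K L]
  [IsScalarTower K R L]

lemma param_eq_eval₂ {k : ℕ} (p : Fin (k + 1) → Fin 2) (f : ChartRing R (k + 1)) :
    param K x L (k + 1) p f = (chartEquiv R k f).eval₂
      (param K x L k (Fin.init p) : ChartRing R k →+* L)
      (param K x L (k + 1) p (newCoord R k)) := by
  refine chartRing_induction K (motive := fun f => param K x L (k + 1) p f =
    (chartEquiv R k f).eval₂ (param K x L k (Fin.init p) : ChartRing R k →+* L)
      (param K x L (k + 1) p (newCoord R k))) f (fun g => ?_) ?_ ?_ ?_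
  · rw [chartEquiv_pull, Polynomial.eval₂_C, param_pull]; rfl
  · rw [chartEquiv_newCoord, Polynomial.eval₂_X]
  · intro f g hf hg
    rw [map_add, map_add, Polynomial.eval₂_add, hf, hg]
  · intro f g hf hg
    rw [map_mul, map_mul, Polynomial.eval₂_mul, hf, hg]

lemma twigSystem_zero [IsAlgClosed K] [CharZero K] [IsLocalization.Away (x 0 * x 1) L]
    (hx : EtaleCoordinates (K := K) x) (ho : ∀ i, o (x i) = 0) (p : Fin 0 → Fin 2) :
    TwigSystem x o L 0 p := by
  have : Algebra.FiniteType K R := hx.finiteType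
  have : IsNoetherianRing R := Algebra.FiniteType.isNoetherianRing K R
  have hCsurj : ∀ f : ChartRing R 0, ∃ r, f = MvPolynomial.C r := fun f => by
    obtain ⟨r, hr⟩ := MvPolynomial.C_surjective (Fin 0) f
    exact ⟨r, hr.symm⟩
  have hspan : ∀ (f : R) (s : Set R), f ∈ Ideal.span s → (MvPolynomial.C f : ChartRing R 0) ∈
      Ideal.span (MvPolynomial.C '' s) := fun f s hf => by
    rw [← Ideal.map_span]; exact Ideal.mem_map_of_mem _ hf
  -- Both coordinates are nonzerodivisors, so `R` embeds into its localization `L`.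
  have hker : RingHom.ker (param K x L 0 p : ChartRing R 0 →+* L) = ⊥ := by
    rw [eq_bot_iff]
    intro f hf
    obtain ⟨r, rfl⟩ := hCsurj f
    rw [RingHom.mem_ker, AlgHom.coe_toRingHom, param_C] at hf
    have hinj := IsLocalization.injective L (M := Submonoid.powers (x 0 * x 1)) (by
      rw [Submonoid.powers_le, mem_nonZeroDivisors_iff_right]
      intro y hy
      refine hx.eq_zero_of_mul_eq_zero 0 (hx.eq_zero_of_mul_eq_zero 1 ?_)
      linear_combination hy)
    rw [hinj (hf.trans (map_zero _).symm), map_zero]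
    exact zero_mem _
  have hrange : ∀ f ∈ nodeIdeal o 0, ∃ s, s ∉ nodeIdeal o 0 ∧ s * f ∈
      Ideal.span {MvPolynomial.C (x 0), MvPolynomial.C (x 1)} := by
    intro f hf
    obtain ⟨r, rfl⟩ := hCsurj f
    have hr : o r = 0 := (node_C o 0 r).symm.trans hf
    obtain ⟨s, hs, h⟩ := hx.exists_mul_mem_span_pair o ho hr
    refine ⟨MvPolynomial.C s, fun h' => hs ((node_C o 0 s).symm.trans h'), ?_⟩
    rw [← map_mul]
    simpa [Set.image_pair] using hspan _ _ h
  have hreg : ∀ (i j : Fin 2) (f : ChartRing R 0), i ≠ j →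
      MvPolynomial.C (x j) * f ∈ Ideal.span {MvPolynomial.C (x i)} →
      f ∈ Ideal.span {MvPolynomial.C (x i)} := by
    intro i j f hij hf
    obtain ⟨r, rfl⟩ := hCsurj f
    obtain ⟨g, hg⟩ := Ideal.mem_span_singleton'.mp hf
    obtain ⟨g, rfl⟩ := hCsurj g
    rw [← map_mul, ← map_mul] at hg
    have h := hx.mem_span_of_mul_mem hij (f := r)
      (Ideal.mem_span_singleton'.mpr ⟨g, MvPolynomial.C_injective _ _ hg⟩)
    simpa using hspan _ _ h
  have hnode : ∀ i, (MvPolynomial.C (x i) : ChartRing R 0) ∈ nodeIdeal o 0 := fun i =>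
    (node_C o 0 _).trans (ho i)
  have hle : ∀ i, twigIdeal x o 0 p i ≤ nodeIdeal o 0 := by
    intro i f hf
    obtain ⟨s, hs, h⟩ := mem_localClosure.mp hf
    refine (Ideal.IsPrime.mem_or_mem inferInstance ?_).resolve_left hs
    exact ((Ideal.span_singleton_le_iff_mem _).mpr (hnode i)) h
  constructor
  · intro i
    refine localClosure_isPrime (nodeIdeal o 0) _ (MvPolynomial.C (x i.rev)) (hnode _) (hnode _)
      ?_ (fun f => hreg _ _ f (rev_ne i).symm)
    fin_cases i
    · exact hrange
    · intro f hf
      obtain ⟨s, hs, h⟩ := hrange f hf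
      exact ⟨s, hs, by rw [Set.pair_comm]; exact h⟩
  · exact hle
  · intro i
    rw [hker]; exact bot_le
  · intro i
    exact le_localClosure (Ideal.mem_span_singleton_self _)
  · intro i h
    obtain ⟨s, hs, h⟩ := mem_localClosure.mp h
    rw [active, mul_comm] at h
    exact hs (((Ideal.span_singleton_le_iff_mem _).mpr (hnode i)) (hreg _ _ _ (rev_ne i).symm h))
  · intro i
    rw [hker, bot_sup_eq]
    exact le_rfl
  · intro f hf
    rw [hker, bot_sup_eq, mem_localClosure]
    obtain ⟨s, hs, h⟩ := hrange f hf
    refine ⟨s, hs, Ideal.span_mono ?_ h⟩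
    rintro _ (rfl | rfl)
    · exact ⟨0, rfl⟩
    · exact ⟨1, rfl⟩

end Twigs

/-! ### Passing to the next level of the tower -/

section TwigStep

variable {K : Type*} {R : Type*} [Field K] [CommRing R] [Algebra K R] {x : Fin 2 → R}
  {o : R →ₐ[K] K} {L : Type*} [CommRing L] [Algebra R L] [Algebra K L] [IsScalarTower K R L]

lemma TwigSystem.eq_of_active_mem {k : ℕ} {p : Fin k → Fin 2} (h : TwigSystem x o L k p)
    {i j : Fin 2} (hij : active K x k p i ∈ twigIdeal x o k p j) : i = j := by
  by_contra hne
  exact h.active_rev_notMem j (eq_rev_of_ne hne ▸ hij)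

variable [CharZero K] (hL : ∀ i, IsUnit (algebraMap R L (x i)))

include hL

/-- On the prolonged curves the deactivated coordinate is a nonzero constant multiple of `n r`. -/
lemma exists_param_deactivated {k : ℕ} (p : Fin (k + 1) → Fin 2) : ∃ c : K, c ≠ 0 ∧
    param K x L (k + 1) p (newCoord R k) * param K x L k (Fin.init p) (retained K x p) =
      param K x L k (Fin.init p) (c • deactivated K x p) := by
  have hb := param_binomial K x hL p
  have hr : (exponent k (Fin.init p) (p (Fin.last k)) : K) ≠ 0 := by
    exact_mod_cast (exponent_pos _ _ _).ne'
  have hd : (exponent k (Fin.init p) (p (Fin.last k)).rev : K) ≠ 0 := by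
    exact_mod_cast (exponent_pos _ _ _).ne'
  generalize exponent k (Fin.init p) (p (Fin.last k)).rev = a at *
  generalize exponent k (Fin.init p) (p (Fin.last k)) = b at *
  refine ⟨-((a : K)⁻¹ * b), neg_ne_zero.mpr (mul_ne_zero (inv_ne_zero hd) hr), ?_⟩
  have ha : algebraMap K L (a : K)⁻¹ * (a : L) = 1 := by
    rw [← map_natCast (algebraMap K L), ← map_mul, inv_mul_cancel₀ hd, map_one]
  rw [map_smul, Algebra.smul_def, map_neg, map_mul, map_natCast]
  linear_combination algebraMap K L (a : K)⁻¹ * hb - (param K x L (k + 1) p (newCoord R k) *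
    param K x L k (Fin.init p) (retained K x p)) * ha

/-- Modulo the kernel, `d` is a constant multiple of `n r`. So `d` may be dropped as a generator as
soon as `n` or `r` is present. -/
lemma pull_deactivated_mem {k : ℕ} (p : Fin (k + 1) → Fin 2) {J : Ideal (ChartRing R (k + 1))}
    (hker : RingHom.ker (param K x L (k + 1) p : ChartRing R (k + 1) →+* L) ≤ J)
    (h : newCoord R k * pull K R k (retained K x p) ∈ J) :
    pull K R k (deactivated K x p) ∈ J := by
  obtain ⟨c, hc, hcd⟩ := exists_param_deactivated (K := K) (L := L) hL p
  have h1 : newCoord R k * pull K R k (retained K x p) - c • pull K R k (deactivated K x p) ∈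
      RingHom.ker (param K x L (k + 1) p : ChartRing R (k + 1) →+* L) := by
    rw [RingHom.mem_ker, AlgHom.coe_toRingHom, map_sub, map_mul, param_pull, hcd, ← map_smul,
      param_pull, sub_self]
  have h2 := J.sub_mem h (hker h1)
  rw [sub_sub_cancel] at h2
  have h3 := J.mul_mem_left (algebraMap K _ c⁻¹) h2
  rwa [← Algebra.smul_def, smul_smul, inv_mul_cancel₀ hc, one_smul] at h3

/-- The coefficients of a polynomial relation between the active coordinates vanish at the node. -/
lemma TwigSystem.coeff_mem_nodeIdeal {k : ℕ} {p : Fin (k + 1) → Fin 2}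
    (h : TwigSystem x o L k (Fin.init p)) (n : ℕ) :
    ∀ F : Polynomial (ChartRing R k), F.natDegree ≤ n →
      F.eval₂ (param K x L k (Fin.init p) : ChartRing R k →+* L)
        (param K x L (k + 1) p (newCoord R k)) = 0 → ∀ j, F.coeff j ∈ nodeIdeal o k := by
  obtain ⟨c, hc, hcd⟩ := exists_param_deactivated (K := K) (L := L) hL p
  have hr_unit := isUnit_param_retained K x hL p
  set ψ : ChartRing R k →+* L := (param K x L k (Fin.init p) : ChartRing R k →+* L) with hψ
  set ν := param K x L (k + 1) p (newCoord R k)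
  have hcd' : ν * ψ (retained K x p) = ψ (c • deactivated K x p) := hcd
  have hprime := h.isPrime (p (Fin.last k))
  have hdq : c • deactivated K x p ∉ twigIdeal x o k (Fin.init p) (p (Fin.last k)) := by
    intro hmem
    have := Ideal.mul_mem_left _ (algebraMap K _ c⁻¹) hmem
    rw [← Algebra.smul_def, smul_smul, inv_mul_cancel₀ hc, one_smul] at this
    exact h.active_rev_notMem _ this
  have hdN : c • deactivated K x p ∈ nodeIdeal o k := by
    rw [Algebra.smul_def]
    exact Ideal.mul_mem_left _ _ (h.le_nodeIdeal _ (h.active_mem (p (Fin.last k)).rev))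
  induction n with
  | zero =>
    intro F hF hF0 j
    rw [Polynomial.eq_C_of_natDegree_le_zero hF] at hF0 ⊢
    rw [Polynomial.eval₂_C] at hF0
    rw [Polynomial.coeff_C]
    split_ifs
    · exact h.le_nodeIdeal 0 (h.ker_le 0 hF0)
    · exact zero_mem _
  | succ n ih =>
    intro F hF hF0
    -- Multiply the relation by `r ^ (n + 1)` and replace `n r` by `c d`. All terms but the leading
    -- one keep a factor `r`, so the leading coefficient times a power of `c d` lies in the prime
    -- ideal of the twig `r = 0`, and `d` does not.
    have hlead : F.coeff (n + 1) ∈ twigIdeal x o k (Fin.init p) (p (Fin.last k)) := by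
      rw [Polynomial.eval₂_eq_sum_range' ψ (n := n + 2) (by omega), Finset.sum_range_succ] at hF0
      have hG : retained K x p * ∑ j ∈ Finset.range (n + 1), F.coeff j *
          (c • deactivated K x p) ^ j * retained K x p ^ (n - j) +
          F.coeff (n + 1) * (c • deactivated K x p) ^ (n + 1) ∈ RingHom.ker ψ := by
        rw [RingHom.mem_ker, map_add, map_mul, map_sum, map_mul, map_pow, ← hcd',
          ← mul_zero (ψ (retained K x p) ^ (n + 1)), ← hF0, mul_add,
          Finset.mul_sum, Finset.mul_sum]
        refine congrArg₂ (· + ·) ?_ ?_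
        · refine Finset.sum_congr rfl fun j hj => ?_
          obtain ⟨m, rfl⟩ := Nat.exists_eq_add_of_le (Nat.lt_succ_iff.mp (Finset.mem_range.mp hj))
          rw [map_mul, map_mul, map_pow, map_pow, ← hcd', Nat.add_sub_cancel_left]
          ring
        · ring
      have h1 := h.ker_le (p (Fin.last k)) hG
      have h2 := Ideal.mul_mem_right (∑ j ∈ Finset.range (n + 1), F.coeff j *
          (c • deactivated K x p) ^ j * retained K x p ^ (n - j)) _
          (h.active_mem (p (Fin.last k)))
      have h3 := (Ideal.add_mem_iff_right _ h2).mp h1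
      exact (hprime.mem_or_mem h3).resolve_right fun h4 => hdq (hprime.mem_of_pow_mem _ h4)
    obtain ⟨s, hs, hsF⟩ := mem_localClosure.mp (h.le_localClosure _ hlead)
    obtain ⟨e, he, g', hg', heg⟩ := Submodule.mem_sup.mp hsF
    obtain ⟨g, rfl⟩ := Ideal.mem_span_singleton'.mp hg'
    have heg' : e + g * retained K x p = s * F.coeff (n + 1) := heg
    -- Locally the leading coefficient is `e + g r` with `e` in the kernel. Subtracting `e X ^ (n +
    -- 1)` and a multiple of the relation `r X = c d` lowers the degree. Below the top, coefficients
    -- change only by the factor `s`, nonzero at the node, and by multiples of `d`, which vanish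
    -- there.
    let F' : Polynomial (ChartRing R k) := Polynomial.C s * F -
      Polynomial.C e * Polynomial.X ^ (n + 1) - Polynomial.C g *
        (Polynomial.C (retained K x p) * Polynomial.X ^ (n + 1) -
          Polynomial.C (c • deactivated K x p) * Polynomial.X ^ n)
    have hcoeff : ∀ j, F'.coeff j = s * F.coeff j - (if j = n + 1 then e else 0) -
        g * ((if j = n + 1 then retained K x p else 0) -
          (if j = n then c • deactivated K x p else 0)) := by
      intro j
      simp only [F', Polynomial.coeff_sub, Polynomial.coeff_C_mul, Polynomial.coeff_X_pow,
        mul_ite, mul_one, mul_zero]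
    have hdeg : F'.natDegree ≤ n := by
      rw [Polynomial.natDegree_le_iff_coeff_eq_zero]
      intro j hj
      rw [hcoeff, if_neg (show j ≠ n by omega)]
      split_ifs with hjn
      · rw [hjn, ← heg']; ring
      · rw [Polynomial.coeff_eq_zero_of_natDegree_lt (by omega)]; ring
    have hF'0 : F'.eval₂ ψ ν = 0 := by
      simp only [F', Polynomial.eval₂_sub, Polynomial.eval₂_mul, Polynomial.eval₂_C,
        Polynomial.eval₂_X_pow, hF0, show ψ e = 0 from he, ← hcd']
      ring
    intro j
    by_cases hj : j = n + 1
    · rw [hj]; exact h.le_nodeIdeal _ hlead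
    · have h1 := ih F' hdeg hF'0 j
      rw [hcoeff, if_neg hj, if_neg hj, sub_zero, zero_sub, mul_neg, sub_neg_eq_add] at h1
      have h2 : g * (if j = n then c • deactivated K x p else 0) ∈ nodeIdeal o k := by
        refine Ideal.mul_mem_left _ _ ?_
        split_ifs
        · exact hdN
        · exact zero_mem _
      have h3 := (Ideal.add_mem_iff_left _ h2).mp h1
      exact (Ideal.IsPrime.mem_or_mem inferInstance h3).resolve_left hs

/-- The relation `n r = c d` drives every part. Only the containment of the kernel is delicate: for
`r = 0` it is the statement on coefficients, and for `n = 0` it is obtained by clearing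
denominators. -/
lemma TwigSystem.succ {k : ℕ} {p : Fin (k + 1) → Fin 2}
    (h : TwigSystem x o L k (Fin.init p)) : TwigSystem x o L (k + 1) p := by
  set q := p (Fin.last k) with hq
  have hcases : ∀ {P : Fin 2 → Prop}, P q → P q.rev → ∀ i, P i := fun h1 h2 i => by
    by_cases hi : i = q
    · rw [hi]; exact h1
    · rw [eq_rev_of_ne hi]; exact h2
  have hker : ∀ g ∈ RingHom.ker (param K x L k (Fin.init p) : ChartRing R k →+* L),
      pull K R k g ∈ RingHom.ker (param K x L (k + 1) p : ChartRing R (k + 1) →+* L) :=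
    fun g hg => (param_pull K x L p g).trans hg
  have hpull : ∀ (I : Ideal (ChartRing R k)) (J : Ideal (ChartRing R (k + 1))),
      I ≤ J.comap (pull K R k) → ∀ g ∈ I, pull K R k g ∈ J := fun I J hIJ g hg => hIJ hg
  have hpr : pull K R k (retained K x p) = active K x (k + 1) p q := (active_last K x p).symm
  have hn : newCoord R k = active K x (k + 1) p q.rev := (active_rev_last K x p).symm
  constructor
  · refine hcases ?_ ?_
    · rw [twigIdeal, if_pos rfl]
      exact RingHom.ker_isPrime _
    · rw [twigIdeal, if_neg (rev_ne _)]
      have := h.isPrime q.rev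
      exact Ideal.comap_isPrime _ _
  · refine hcases ?_ ?_
    · intro f hf
      have := mem_twigIdeal_last.mp hf 0
      rw [Polynomial.coeff_zero_eq_eval_zero] at this
      exact (eval_node_chartEquiv o k f).symm.trans this
    · intro f hf
      exact (eval_node_chartEquiv o k f).symm.trans
        (h.le_nodeIdeal _ (mem_twigIdeal_rev_last.mp hf))
  · refine hcases ?_ ?_
    · intro f hf
      exact mem_twigIdeal_last.mpr (h.coeff_mem_nodeIdeal hL _ _ le_rfl
        ((param_eq_eval₂ p f).symm.trans hf))
    · intro f hf
      rw [mem_twigIdeal_rev_last]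
      have hprime := h.isPrime q.rev
      have hf0 := (param_eq_eval₂ p f).symm.trans hf
      obtain ⟨c, hc, hcd⟩ := exists_param_deactivated (K := K) (L := L) hL p
      rw [Polynomial.eval₂_eq_sum_range' _ (n := (chartEquiv R k f).natDegree + 1) (by omega),
        Finset.sum_range_succ'] at hf0
      generalize (chartEquiv R k f).natDegree = m at hf0
      generalize chartEquiv R k f = F at hf0 ⊢
      -- The relation times `r ^ m`, with `n r` replaced by `c d`. Modulo the twig `d = 0` only `r ^
      -- m * F(0)` survives, and `r` is not in that prime ideal.
      have hG : (c • deactivated K x p) * (∑ j ∈ Finset.range m, F.coeff (j + 1) *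
          (c • deactivated K x p) ^ j * retained K x p ^ (m - (j + 1))) +
          retained K x p ^ m * F.coeff 0 ∈
          RingHom.ker (param K x L k (Fin.init p) : ChartRing R k →+* L) := by
        rw [RingHom.mem_ker, AlgHom.coe_toRingHom, map_add, map_mul, map_sum, map_mul, map_pow,
          ← hcd, ← mul_zero (param K x L k (Fin.init p) (retained K x p) ^ m), ← hf0, mul_add,
          Finset.mul_sum, Finset.mul_sum]
        refine congrArg₂ (· + ·) ?_ ?_
        · refine Finset.sum_congr rfl fun j hj => ?_
          obtain ⟨l, rfl⟩ := Nat.exists_eq_add_of_lt (Finset.mem_range.mp hj)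
          rw [map_mul, map_mul, map_pow, map_pow, ← hcd, show j + l + 1 - (j + 1) = l by omega,
            AlgHom.coe_toRingHom]
          ring
        · rw [AlgHom.coe_toRingHom]; ring
      have h1 := h.ker_le q.rev hG
      have h2 : (c • deactivated K x p) * (∑ j ∈ Finset.range m, F.coeff (j + 1) *
          (c • deactivated K x p) ^ j * retained K x p ^ (m - (j + 1))) ∈
          twigIdeal x o k (Fin.init p) q.rev := by
        rw [Algebra.smul_def, mul_assoc, mul_left_comm]
        exact Ideal.mul_mem_right _ _ (h.active_mem q.rev)
      have h3 := (Ideal.add_mem_iff_right _ h2).mp h1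
      rw [← Polynomial.coeff_zero_eq_eval_zero]
      refine (hprime.mem_or_mem h3).resolve_left fun h4 => ?_
      have h5 := h.active_rev_notMem q.rev
      rw [Fin.rev_rev] at h5
      exact h5 (hprime.mem_of_pow_mem _ h4)
  · refine hcases ?_ ?_
    · rw [← hpr]
      refine mem_twigIdeal_last.mpr fun j => ?_
      rw [chartEquiv_pull, Polynomial.coeff_C]
      split_ifs
      · exact h.le_nodeIdeal _ (h.active_mem q)
      · exact zero_mem _
    · rw [← hn]
      refine mem_twigIdeal_rev_last.mpr ?_
      rw [chartEquiv_newCoord, Polynomial.eval_X]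
      exact zero_mem _
  · refine hcases ?_ ?_
    · rw [← hn]
      intro hmem
      have h1 := mem_twigIdeal_last.mp hmem 1
      rw [chartEquiv_newCoord, Polynomial.coeff_X_one] at h1
      exact (Ideal.ne_top_iff_one _).mp (Ideal.IsPrime.ne_top inferInstance) h1
    · rw [Fin.rev_rev, ← hpr]
      intro hmem
      have h1 := mem_twigIdeal_rev_last.mp hmem
      rw [chartEquiv_pull, Polynomial.eval_C] at h1
      have h5 := h.active_rev_notMem q.rev
      rw [Fin.rev_rev] at h5
      exact h5 h1
  · refine hcases ?_ ?_
    · intro f hf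
      -- The coefficients of `f` lie in the ideal of the node below, which is locally generated by
      -- the kernel, `r` and `d`; and `d` is redundant once `r` is given.
      rw [← (chartEquiv R k).symm_apply_apply f, (chartEquiv R k f).as_sum_range_C_mul_X_pow,
        map_sum]
      refine Ideal.sum_mem _ fun j _ => ?_
      rw [map_mul, map_pow, chartEquiv_symm_C K, chartEquiv_symm_X]
      refine Ideal.mul_mem_right _ _ (pull_mem_localClosure ?_
        (h.nodeIdeal_le_localClosure (mem_twigIdeal_last.mp hf j)))
      refine hpull _ _ (sup_le (fun g hg => Ideal.mem_sup_left (hker g hg)) ?_)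
      rw [Ideal.span_le]
      rintro _ ⟨i, rfl⟩
      have hr : pull K R k (retained K x p) ∈ RingHom.ker (param K x L (k + 1) p :
          ChartRing R (k + 1) →+* L) ⊔ Ideal.span {active K x (k + 1) p q} := by
        rw [hpr]
        exact Ideal.mem_sup_right (Ideal.mem_span_singleton_self _)
      revert i
      exact hcases hr (pull_deactivated_mem hL p le_sup_left (Ideal.mul_mem_left _ _ hr))
    · intro f hf
      obtain ⟨g, hg⟩ := exists_eq_pull_add K k f
      have hnmem : newCoord R k ∈ RingHom.ker (param K x L (k + 1) p :
          ChartRing R (k + 1) →+* L) ⊔ Ideal.span {active K x (k + 1) p q.rev} := by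
        rw [← hn]
        exact Ideal.mem_sup_right (Ideal.mem_span_singleton_self _)
      rw [hg]
      refine Ideal.add_mem _ (pull_mem_localClosure ?_
        (h.le_localClosure _ (mem_twigIdeal_rev_last.mp hf)))
        (Ideal.mul_mem_right _ _ (NodalProlongation.le_localClosure hnmem))
      refine hpull _ _ (sup_le (fun g hg => Ideal.mem_sup_left (hker g hg)) ?_)
      rw [Ideal.span_singleton_le_iff_mem]
      exact pull_deactivated_mem hL p le_sup_left (Ideal.mul_mem_right _ _ hnmem)
  · intro f hf
    obtain ⟨g, hg⟩ := exists_eq_pull_add K k f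
    have hmem : ∀ i, active K x (k + 1) p i ∈ RingHom.ker (param K x L (k + 1) p :
        ChartRing R (k + 1) →+* L) ⊔ Ideal.span (Set.range (active K x (k + 1) p)) := fun i =>
      Ideal.mem_sup_right (Ideal.subset_span ⟨i, rfl⟩)
    have hnmem := hmem q.rev
    have hrmem := hmem q
    rw [← hn] at hnmem
    rw [← hpr] at hrmem
    rw [hg]
    refine Ideal.add_mem _ (pull_mem_localClosure ?_ (h.nodeIdeal_le_localClosure
      ((eval_node_chartEquiv o k f).trans hf)))
      (Ideal.mul_mem_right _ _ (NodalProlongation.le_localClosure hnmem))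
    refine hpull _ _ (sup_le (fun g hg => Ideal.mem_sup_left (hker g hg)) ?_)
    rw [Ideal.span_le]
    rintro _ ⟨i, rfl⟩
    revert i
    exact hcases hrmem (pull_deactivated_mem hL p le_sup_left (Ideal.mul_mem_right _ _ hnmem))

end TwigStep

/-! ### Minimal primes and lengths -/

section Components

variable {K : Type*} {R : Type*} [Field K] [CommRing R] [Algebra K R] {x : Fin 2 → R}
  {o : R →ₐ[K] K} {L : Type*} [CommRing L] [Algebra R L] [Algebra K L] [IsScalarTower K R L]
  [CharZero K]

/-- The central member as the zero scheme of a monomial in the active coordinates. -/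
lemma centralIdeal_eq_monomial (hL : ∀ i, IsUnit (algebraMap R L (x i))) {k : ℕ}
    {p : Fin k → Fin 2}
    (hJ : centralIdeal K x k p = RingHom.ker (param K x L k p : ChartRing R k →+* L) ⊔
      Ideal.span {MvPolynomial.C (x 0 * x 1)}) (i : Fin 2) :
    centralIdeal K x k p = RingHom.ker (param K x L k p : ChartRing R k →+* L) ⊔
      Ideal.span {active K x k p i ^ exponent k p i *
        active K x k p i.rev ^ exponent k p i.rev} := by
  obtain ⟨c, hc, h⟩ := exists_param_monomial K x hL k p
  have h' : algebraMap R L (x 0 * x 1) = algebraMap K L c *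
      (param K x L k p (active K x k p i ^ exponent k p i *
        active K x k p i.rev ^ exponent k p i.rev)) := by
    rw [h, map_mul, map_pow, map_pow]
    fin_cases i
    · rfl
    · exact congrArg _ (mul_comm _ _)
  generalize active K x k p i ^ exponent k p i * active K x k p i.rev ^ exponent k p i.rev = M at *
  have hker : MvPolynomial.C (x 0 * x 1) - algebraMap K (ChartRing R k) c * M ∈
      RingHom.ker (param K x L k p : ChartRing R k →+* L) := by
    rw [RingHom.mem_ker, AlgHom.coe_toRingHom, map_sub, param_C, h', map_mul, AlgHom.commutes,
      sub_self]
  rw [hJ]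
  apply le_antisymm
  · refine sup_le le_sup_left ?_
    rw [Ideal.span_singleton_le_iff_mem, ← sub_add_cancel (MvPolynomial.C (x 0 * x 1))
      (algebraMap K (ChartRing R k) c * M)]
    exact Ideal.add_mem _ (Ideal.mem_sup_left hker)
      (Ideal.mem_sup_right (Ideal.mul_mem_left _ _ (Ideal.mem_span_singleton_self _)))
  · refine sup_le le_sup_left ?_
    rw [Ideal.span_singleton_le_iff_mem]
    have h1 : algebraMap K (ChartRing R k) c * M ∈
        RingHom.ker (param K x L k p : ChartRing R k →+* L) ⊔
          Ideal.span {MvPolynomial.C (x 0 * x 1)} := by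
      rw [← sub_sub_cancel (MvPolynomial.C (x 0 * x 1)) (algebraMap K (ChartRing R k) c * M)]
      exact Ideal.sub_mem _ (Ideal.mem_sup_right (Ideal.mem_span_singleton_self _))
        (Ideal.mem_sup_left hker)
    have h2 := Ideal.mul_mem_left _ (algebraMap K (ChartRing R k) c⁻¹) h1
    rwa [← mul_assoc, ← map_mul, inv_mul_cancel₀ hc, map_one, one_mul] at h2

omit [CharZero K] in
/-- The twigs through the node are the two components on which an active coordinate vanishes. -/
lemma TwigSystem.isTwig_iff {k : ℕ} {p : Fin k → Fin 2} (h : TwigSystem x o L k p)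
    (hJ : ∀ i, centralIdeal K x k p = RingHom.ker (param K x L k p : ChartRing R k →+* L) ⊔
      Ideal.span {active K x k p i ^ exponent k p i *
        active K x k p i.rev ^ exponent k p i.rev}) (P : PrimeSpectrum (ChartRing R k)) :
    IsTwig x o k p P ↔ ∃ i, P.asIdeal = twigIdeal x o k p i := by
  have hle : ∀ i, centralIdeal K x k p ≤ twigIdeal x o k p i := by
    intro i
    rw [hJ i]
    refine sup_le (h.ker_le i) ?_
    rw [Ideal.span_singleton_le_iff_mem]
    exact Ideal.mul_mem_right _ _ (Ideal.pow_mem_of_mem _ (h.active_mem i) _ (exponent_pos _ _ _))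
  -- A prime over the monomial contains an active coordinate. If it also lies in the ideal of the
  -- node, local generation suffices: the denominators `s` stay outside it.
  have hge : ∀ Q : Ideal (ChartRing R k), Q.IsPrime → centralIdeal K x k p ≤ Q →
      Q ≤ nodeIdeal o k → ∃ i, twigIdeal x o k p i ≤ Q := by
    intro Q hQ hJQ hQN
    have hkQ : RingHom.ker (param K x L k p : ChartRing R k →+* L) ≤ Q :=
      (le_sup_left.trans (hJ 0).ge).trans hJQ
    have hmon : active K x k p 0 ^ exponent k p 0 *
        active K x k p (Fin.rev 0) ^ exponent k p (Fin.rev 0) ∈ Q :=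
      hJQ ((hJ 0).ge (Ideal.mem_sup_right (Ideal.mem_span_singleton_self _)))
    have hact : ∃ i, active K x k p i ∈ Q := by
      rcases hQ.mem_or_mem hmon with h' | h'
      · exact ⟨_, hQ.mem_of_pow_mem _ h'⟩
      · exact ⟨_, hQ.mem_of_pow_mem _ h'⟩
    obtain ⟨i, hi⟩ := hact
    refine ⟨i, fun f hf => ?_⟩
    obtain ⟨s, hs, hsf⟩ := mem_localClosure.mp (h.le_localClosure i hf)
    have hsQ : s * f ∈ Q :=
      (sup_le hkQ ((Ideal.span_singleton_le_iff_mem _).mpr hi)) hsf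
    exact (hQ.mem_or_mem hsQ).resolve_left fun hs' => hs (hQN hs')
  constructor
  · rintro ⟨hmin, hN⟩
    obtain ⟨i, hi⟩ := hge _ P.isPrime hmin.1.2 hN
    exact ⟨i, le_antisymm (hmin.2 ⟨h.isPrime i, hle i⟩ hi) hi⟩
  · rintro ⟨i, hi⟩
    refine ⟨?_, hi ▸ h.le_nodeIdeal i⟩
    rw [hi]
    refine ⟨⟨h.isPrime i, hle i⟩, ?_⟩
    rintro Q ⟨hQ, hJQ⟩ hQi
    obtain ⟨j, hj⟩ := hge Q hQ hJQ (hQi.trans (h.le_nodeIdeal i))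
    have := h.eq_of_active_mem (hQi (hj (h.active_mem j)))
    exact this ▸ hj

/-- The multiplicity of a twig is the exponent of the corresponding active coordinate. -/
lemma TwigSystem.multiplicity_eq (hL : ∀ i, IsUnit (algebraMap R L (x i))) {k : ℕ}
    {p : Fin k → Fin 2} (h : TwigSystem x o L k p)
    (hJ : ∀ i, centralIdeal K x k p = RingHom.ker (param K x L k p : ChartRing R k →+* L) ⊔
      Ideal.span {active K x k p i ^ exponent k p i *
        active K x k p i.rev ^ exponent k p i.rev}) (P : PrimeSpectrum (ChartRing R k)) (i : Fin 2)
    (hP : P.asIdeal = twigIdeal x o k p i) :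
    multiplicity (centralIdeal K x k p) P = exponent k p i := by
  let A := Localization.AtPrime P.asIdeal
  let φ := algebraMap (ChartRing R k) A
  have hmax : IsLocalRing.maximalIdeal A = P.asIdeal.map φ :=
    (Localization.AtPrime.map_eq_maximalIdeal (I := P.asIdeal)).symm
  have hunit : ∀ s, s ∉ P.asIdeal → IsUnit (φ s) := fun s hs =>
    IsLocalization.map_units A (⟨s, hs⟩ : P.asIdeal.primeCompl)
  have hkJ : RingHom.ker (param K x L k p : ChartRing R k →+* L) ≤ centralIdeal K x k p :=
    le_sup_left.trans (hJ i).ge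
  refine length_quotient_eq_of_maximalIdeal_le (φ (active K x k p i)) ?_ _ _ ?_ ?_ ?_
  · rw [hmax]
    exact Ideal.mem_map_of_mem _ (hP.ge (h.active_mem i))
  · rw [hmax, Ideal.map_le_iff_le_comap]
    intro f hf
    rw [hP] at hf
    obtain ⟨s, hs, hsf⟩ := mem_localClosure.mp (h.le_localClosure i hf)
    have hsP : s ∉ P.asIdeal := fun hs' => hs (h.le_nodeIdeal i (hP ▸ hs'))
    rw [Ideal.mem_comap, ← Ideal.unit_mul_mem_iff_mem _ (hunit s hsP), ← map_mul]
    have h1 := Ideal.mem_map_of_mem φ hsf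
    rw [Ideal.map_sup, Ideal.map_span, Set.image_singleton] at h1
    have h2 : (RingHom.ker (param K x L k p : ChartRing R k →+* L)).map φ ⊔
        Ideal.span {φ (active K x k p i)} ≤
        (centralIdeal K x k p).map φ ⊔ Ideal.span {φ (active K x k p i)} :=
      sup_le_sup_right (Ideal.map_mono hkJ) _
    exact h2 h1
  · have h1 : φ (active K x k p i ^ exponent k p i * active K x k p i.rev ^ exponent k p i.rev) ∈
        (centralIdeal K x k p).map φ :=
      Ideal.mem_map_of_mem _ ((hJ i).ge (Ideal.mem_sup_right (Ideal.mem_span_singleton_self _)))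
    have hu : IsUnit (φ (active K x k p i.rev) ^ exponent k p i.rev) :=
      (hunit _ fun h' => h.active_rev_notMem i (hP ▸ h')).pow _
    rw [map_mul, map_pow, map_pow, mul_comm] at h1
    exact (Ideal.unit_mul_mem_iff_mem _ hu).mp h1
  -- If `s u ^ j` were in the central ideal with `j` below the exponent, then `u ^ j`, a unit in
  -- `L`, could be cancelled after `param`. That puts `s` in the kernel plus `(u)`, hence in the
  -- twig.
  · intro j hj hmem
    rw [← map_pow] at hmem
    obtain ⟨s, hs, hsj⟩ := mem_localClosure.mp (show _ ∈ localClosure _ _ from hmem)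
    rw [hJ i] at hsj
    obtain ⟨e, he, g', hg', heg⟩ := Submodule.mem_sup.mp hsj
    obtain ⟨g, rfl⟩ := Ideal.mem_span_singleton'.mp hg'
    refine hs ?_
    obtain ⟨m, hm⟩ := Nat.exists_eq_add_of_lt hj
    have hu := (isUnit_param_active K x hL k p i).pow j
    have hker : s - g * active K x k p i ^ (m + 1) * active K x k p i.rev ^ exponent k p i.rev ∈
        RingHom.ker (param K x L k p : ChartRing R k →+* L) := by
      rw [RingHom.mem_ker, AlgHom.coe_toRingHom]
      refine hu.mul_left_cancel ?_
      have h2 : param K x L k p (e + g * (active K x k p i ^ exponent k p i *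
        active K x k p i.rev ^ exponent k p i.rev)) =
        param K x L k p (s * active K x k p i ^ j) := congrArg _ heg
      rw [map_add, show param K x L k p e = 0 from he, hm] at h2
      simp only [map_mul, map_pow, map_sub] at h2 ⊢
      linear_combination -h2
    rw [hP, ← sub_add_cancel s (g * active K x k p i ^ (m + 1) *
      active K x k p i.rev ^ exponent k p i.rev)]
    refine Ideal.add_mem _ (h.ker_le i hker) (Ideal.mul_mem_right _ _ (Ideal.mul_mem_left _ _
      (Ideal.pow_mem_of_mem _ (h.active_mem i) _ m.succ_pos)))

end Components

/-! ### Uniqueness of the coefficients of the node binomial -/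

section NodeBinomial

variable {K : Type*} {R : Type*} [Field K] [CommRing R] [Algebra K R] {x : Fin 2 → R} [CharZero K]

/-- The coefficients of the binomial as a polynomial in `n` are `b d` and `a r`; in characteristic
zero these determine `a` and `b`, since `r` and `d` are nonzero. -/
lemma binomial_injective {k : ℕ} (p : Fin (k + 1) → Fin 2)
    (hne : ∀ i, active K x k (Fin.init p) i ≠ 0) {a b α β : ℕ}
    (h : binomial K x p a b = binomial K x p α β) : a = α ∧ b = β := by
  have hcancel : ∀ (f : ChartRing R k) (m n : ℕ), f ≠ 0 →
      (m : ChartRing R k) * f = (n : ChartRing R k) * f → m = n := by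
    intro f m n hf hmn
    have h1 : ((m : K) - n) • f = 0 := by
      rw [sub_smul, Algebra.smul_def, Algebra.smul_def, map_natCast, map_natCast, hmn, sub_self]
    have h2 := (smul_eq_zero.mp h1).resolve_right hf
    exact_mod_cast sub_eq_zero.mp h2
  have h' := congrArg (chartEquiv R k) h
  simp only [binomial, map_add, map_mul, map_natCast, chartEquiv_pull, chartEquiv_newCoord] at h'
  have h0 := congrArg (fun F => Polynomial.coeff F 0) h'
  have h1 := congrArg (fun F => Polynomial.coeff F 1) h'
  simp only [Polynomial.coeff_add, Polynomial.coeff_mul_C, Polynomial.coeff_natCast_mul,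
    Polynomial.coeff_X_one, Polynomial.coeff_X_zero, mul_zero, zero_mul, zero_add, mul_one,
    Polynomial.coeff_natCast_ite, one_ne_zero, if_true, if_false, Nat.cast_zero, add_zero] at h0 h1
  exact ⟨hcancel (retained K x p) _ _ (hne _) h1, hcancel (deactivated K x p) _ _ (hne _) h0⟩

end NodeBinomial

end NodalProlongation

/-! ### The retained and the emergent twig -/

open NodalProlongation

theorem theorem5p1 {K : Type*} [Field K] [IsAlgClosed K] [CharZero K]
    {R : Type*} [CommRing R] [Algebra K R] (x : Fin 2 → R)
    (hx : (MvPolynomial.aeval x : MvPolynomial (Fin 2) K →ₐ[K] R).toRingHom.Etale)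
    (o : R →ₐ[K] K) (ho : ∀ i, o (x i) = 0)
    (k : ℕ) (p : Fin (k + 1) → Fin 2) (α β : ℕ)
    (hB : NodalProlongation.nodeBinomial K x p = NodalProlongation.binomial K x p α β) :
    ∃ ret em : PrimeSpectrum (NodalProlongation.ChartRing R (k + 1)),
      ret ≠ em ∧
      (∀ P, NodalProlongation.IsTwig x o (k + 1) p P ↔ P = ret ∨ P = em) ∧
      (∀ P, NodalProlongation.IsRetained x o p P ↔ P = ret) ∧
      (∀ P, NodalProlongation.IsEmergent x o p P ↔ P = em) ∧
      NodalProlongation.multiplicity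
        (NodalProlongation.centralIdeal K x (k + 1) p) ret = (α : ℕ∞) ∧
      NodalProlongation.multiplicity
        (NodalProlongation.centralIdeal K x (k + 1) p) em = ((α + β : ℕ) : ℕ∞) := by
  have hx' : EtaleCoordinates (K := K) x := hx
  have : Algebra.FiniteType K R := hx'.finiteType
  have : IsReduced R := hx'.isReduced
  let L := Localization.Away (x 0 * x 1)
  have hLred : IsReduced L := isReduced_localizationPreserves (Submonoid.powers (x 0 * x 1)) L inferInstance
  have : Algebra.FormallyEtale R L :=
    Algebra.FormallyEtale.of_isLocalization (Submonoid.powers (x 0 * x 1))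
  have : Algebra.FiniteType R L := IsLocalization.finiteType_of_monoid_fg
    (Submonoid.powers (x 0 * x 1)) L
  have : Algebra.FiniteType K L := Algebra.FiniteType.trans (S := R) inferInstance inferInstance
  have hL : ∀ i, IsUnit (algebraMap R L (x i)) := by
    have h : IsUnit (algebraMap R L (x 0 * x 1)) :=
      IsLocalization.Away.algebraMap_isUnit (x 0 * x 1)
    rw [map_mul, IsUnit.mul_iff] at h
    intro i
    fin_cases i
    · exact h.1
    · exact h.2
  obtain ⟨D, h0, h1⟩ := hx'.exists_derivation L
  have hJ : ∀ (k : ℕ) (p : Fin k → Fin 2) (i : Fin 2), _ := fun k p i =>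
    centralIdeal_eq_monomial hL (centralIdeal_eq hL hx' h0 h1 k p) i
  have hsys : ∀ (k : ℕ) (p : Fin k → Fin 2), TwigSystem x o L k p := by
    intro k
    induction k with
    | zero => exact twigSystem_zero hx' ho
    | succ k ih => exact fun p => (ih (Fin.init p)).succ hL
  have htwig : ∀ (k : ℕ) (p : Fin k → Fin 2) (P : PrimeSpectrum (ChartRing R k)),
      IsTwig x o k p P ↔ ∃ i, P.asIdeal = twigIdeal x o k p i :=
    fun k p => (hsys k p).isTwig_iff (hJ k p)
  have hne : ∀ i, active K x k (Fin.init p) i ≠ 0 := fun i hi => by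
    have := (hsys k (Fin.init p)).active_rev_notMem i.rev
    rw [Fin.rev_rev, hi] at this
    exact this (zero_mem _)
  rw [nodeBinomial] at hB
  obtain ⟨hα, hβ⟩ := binomial_injective p hne hB
  rw [nodeCoeffs_succ] at hα hβ
  set q := p (Fin.last k) with hq
  let ret : PrimeSpectrum (ChartRing R (k + 1)) :=
    ⟨twigIdeal x o (k + 1) p q.rev, (hsys (k + 1) p).isPrime _⟩
  let em : PrimeSpectrum (ChartRing R (k + 1)) :=
    ⟨twigIdeal x o (k + 1) p q, (hsys (k + 1) p).isPrime _⟩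
  have htwig' : ∀ P, IsTwig x o (k + 1) p P ↔ P = ret ∨ P = em := by
    intro P
    rw [htwig, PrimeSpectrum.ext_iff, PrimeSpectrum.ext_iff]
    constructor
    · rintro ⟨i, hi⟩
      by_cases h : i = q
      · rw [h] at hi
        exact Or.inr hi
      · rw [eq_rev_of_ne h] at hi
        exact Or.inl hi
    · rintro (h | h)
      · exact ⟨_, h⟩
      · exact ⟨_, h⟩
  -- A twig is never just the node, because the other active coordinate does not vanish identically
  -- on it. Hence no twig can be both retained and emergent.
  have hnode : ∀ i, nodeIdeal o k ≠ twigIdeal x o k (Fin.init p) i := fun i h =>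
    (hsys k _).active_rev_notMem i (h ▸ (hsys k _).le_nodeIdeal _ ((hsys k _).active_mem _))
  have hem : (imageTwig K em).asIdeal = nodeIdeal o k := by
    ext f
    refine (mem_twigIdeal_last (f := pull K R k f)).trans ?_
    rw [chartEquiv_pull]
    refine ⟨fun h => by simpa using h 0, fun h j => ?_⟩
    rw [Polynomial.coeff_C]
    split_ifs
    · exact h
    · exact zero_mem _
  have hret : (imageTwig K ret).asIdeal = twigIdeal x o k (Fin.init p) q.rev := by
    ext f
    refine (mem_twigIdeal_rev_last (f := pull K R k f)).trans ?_
    rw [chartEquiv_pull, Polynomial.eval_C]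
  have hretem : ret ≠ em := fun h => by
    have h1 : em.asIdeal ≤ ret.asIdeal := h ▸ le_rfl
    exact rev_ne q ((hsys (k + 1) p).eq_of_active_mem (h1 ((hsys (k + 1) p).active_mem q))).symm
  refine ⟨ret, em, hretem, htwig', fun P => ⟨?_, ?_⟩, fun P => ⟨?_, ?_⟩, ?_, ?_⟩
  · rintro ⟨hP, hP', -⟩
    refine ((htwig' P).mp hP).resolve_right ?_
    rintro rfl
    obtain ⟨i, hi⟩ := (htwig _ _ _).mp hP'
    exact hnode i (hem.symm.trans hi)
  · rintro rfl
    refine ⟨(htwig' _).mpr (Or.inl rfl), (htwig _ _ _).mpr ⟨_, hret⟩,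
      Ideal.quotientMap_injective, fun f => ?_⟩
    obtain ⟨f, rfl⟩ := Ideal.Quotient.mk_surjective f
    -- Surjectivity: on the retained twig `n = 0`, so every function agrees with the pullback of its
    -- value at `n = 0`.
    obtain ⟨g, hg⟩ := exists_eq_pull_add K k f
    refine ⟨Ideal.Quotient.mk _ ((chartEquiv R k f).eval 0), ?_⟩
    rw [Ideal.quotientMap_mk, Ideal.Quotient.eq]
    have hn : newCoord R k ∈ ret.asIdeal := by
      rw [← active_rev_last K x p]
      exact (hsys (k + 1) p).active_mem _
    have hsub : pull K R k ((chartEquiv R k f).eval 0) - f = newCoord R k * -g := by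
      linear_combination -hg
    exact hsub ▸ Ideal.mul_mem_right _ _ hn
  · rintro ⟨hP, hP'⟩
    refine ((htwig' P).mp hP).resolve_left ?_
    rintro rfl
    exact hnode _ (hP'.symm.trans hret)
  · rintro rfl
    exact ⟨(htwig' _).mpr (Or.inr rfl), hem⟩
  · rw [(hsys (k + 1) p).multiplicity_eq hL (hJ (k + 1) p) ret q.rev rfl, exponent_rev_last, ← hα]
  · rw [(hsys (k + 1) p).multiplicity_eq hL (hJ (k + 1) p) em q rfl, exponent_last, ← hα, ← hβ,
      add_comm]
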